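/- Let $G=(V,E)$ be a finite simple graph with edge weights $w\in\mathbb R^E_{\ge 0}$. A fractional matching is a vector $x\in\mathbb R^E_{\ge 0}$ with $x(\delta(v))\le 1$ for all $v\in V$; it is basic if it is an extreme point of the polytope of fractional matchings, and maximum-weight if it maximizes $w^\top x$ over that polytope. A fractional $w$-vertex cover is a vector $y\in\mathbb R^V_{\ge 0}$ with $y_u+y_v\ge w_{uv}$ for all $uv\in E$; it is minimum if it minimizes $\sum_v y_v$. For a basic fractional matching $x$ let $\mathscr C(x)$ be the set of odd cycles $C$ of $G$ with $x_e=\frac12$ for all $e\in E(C)$, let $V(\mathscr C(x))=\bigcup_{C\in\mathscr C(x)}V(C)$, and let $M(x)=\{e\in E: x_e=1\}$. Let $\gamma(G)$ be the minimum of $|\mathscr C(x)|$ over all basic maximum-weight fractional matchings $x$. A path is $M$-alternating if its edges belong alternately to $M$ and to $E\setminus M$; it is valid if it starts with an $M$-exposed vertex or an edge of $M$, and ends with an $M$-exposed vertex or an edge of $M$. Given $y$, a path is tight if $y_u+y_v=w_{uv}$ for each of its edges $uv$. Complementing on $E'\subseteq E$ means replacing $x_e$ by $1-x_e$ for all $e\in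 E'$. Alternate rounding on an odd cycle $C$ at $v\in V(C)$, where $e_1,\dots,e_{2k+1}$ are the edges of $C$ in cyclic order, $e_1$ and $e_{2k+1}$ being the two incident to $v$, means replacing $x_e$ by $0$ on $e_1,e_3,\dots,e_{2k+1}$ and by $1$ on $e_2,e_4,\dots,e_{2k}$. **Theorem.** Let $\hat x$ be a basic maximum-weight fractional matching and $y$ a minimum fractional $w$-vertex cover in $G$. If $|\mathscr C(\hat x)|>\gamma(G)$, then there exists 1. a vertex $v\in V(C_i)$ for some $C_i\in\mathscr C(\hat x)$ such that $y_v=0$; or 2. a tight $M(\hat x)$-alternating path $P$ from a vertex $u\in V(C_i)$ to a vertex $v\in V(C_j)$ for two different cycles $C_i,C_j\in\mathscr C(\hat x)$; or 3. a tight and valid $M(\hat x)$-alternating path $P$ from a vertex $u\in V(C_i)$ for some $C_i\in\mathscr C(\hat x)$ to a vertex $v\notin V(\mathscr C(\hat x))$ such that $y_v=0$. Furthermore, for every structure as in 1, 2 or 3 (whether or not $|\mathscr C(\hat x)|>\gamma(G)$), let $\bar x$ be obtained from $\hat x$ by, respectively: alternate rounding on $C_i$ at $v$; alternate rounding on $C_i$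 at $u$ and on $C_j$ at $v$ and complementing on $E(P)$; alternate rounding on $C_i$ at $u$ and complementing on $E(P)$. Then $\bar x$ is a basic maximum-weight fractional matching and $\mathscr C(\bar x)\subsetneq\mathscr C(\hat x)$. -/

import Mathlib

namespace FractionalMatching

section LinearPrograms

variable {V : Type*} [Fintype V] [DecidableEq V] (G : SimpleGraph V) [DecidableRel G.Adj]

/-- The fractional matching polytope: all `x : E → ℝ` with `x ≥ 0` and `x(δ(v)) ≤ 1` for every
vertex `v`, where `δ(v)` is the set of edges incident to `v`. -/
def fractionalMatchings : Set (G.edgeSet → ℝ) :=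
  {x | (∀ e, 0 ≤ x e) ∧
    ∀ v, ∑ e ∈ Finset.univ.filter (fun e : G.edgeSet => v ∈ (e : Sym2 V)), x e ≤ 1}

/-- The optimal solutions of the linear program `max {wᵀx : x a fractional matching}`. -/
def maxFractionalMatchings (w : G.edgeSet → ℝ) : Set (G.edgeSet → ℝ) :=
  {x | x ∈ fractionalMatchings G ∧
    ∀ x' ∈ fractionalMatchings G, ∑ e, w e * x' e ≤ ∑ e, w e * x e}

/-- The basic maximum-weight fractional matchings. The basic feasible solutions of a linear
program are the extreme points of its feasible region. -/
def basicMaxFractionalMatchings (w : G.edgeSet → ℝ) : Set (G.edgeSet → ℝ) :=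
  {x | x ∈ (fractionalMatchings G).extremePoints ℝ ∧ x ∈ maxFractionalMatchings G w}

end LinearPrograms

section Covers

variable {V : Type*} (G : SimpleGraph V)

/-- The fractional `w`-vertex covers: all `y ≥ 0` with `y_u + y_v ≥ w_{uv}` for every edge. -/
def fractionalCovers (w : G.edgeSet → ℝ) : Set (V → ℝ) :=
  {y | (∀ v, 0 ≤ y v) ∧ ∀ (u v : V) (h : G.Adj u v), w ⟨s(u, v), h⟩ ≤ y u + y v}

/-- The fractional `w`-vertex covers `y` of minimum value `1ᵀy`. -/
def minFractionalCovers [Fintype V] (w : G.edgeSet → ℝ) : Set (V → ℝ) :=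
  {y | y ∈ fractionalCovers G w ∧ ∀ y' ∈ fractionalCovers G w, ∑ v, y v ≤ ∑ v, y' v}

end Covers

section Support

variable {V : Type*} [DecidableEq V] {G : SimpleGraph V}

/-- `c`, a closed walk at `v`, runs once around the cycle of `G` whose edge set is `C`. -/
def Traverses {v : V} (c : G.Walk v v) (C : Finset (Sym2 V)) : Prop :=
  c.IsCycle ∧ c.edges.toFinset = C

/-- `𝒞(x)`: the odd cycles of `G` (given by their edge sets) all of whose edges have
value `1/2`. -/
def oddCycles (x : G.edgeSet → ℝ) : Set (Finset (Sym2 V)) :=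
  {C | (∃ (v : V) (c : G.Walk v v), Traverses c C) ∧ Odd C.card ∧
    ∀ e : G.edgeSet, (e : Sym2 V) ∈ C → x e = 1 / 2}

/-- The vertex set of the cycle with edge set `C`. -/
def cycleVertices (C : Finset (Sym2 V)) : Set V := {v | ∃ e ∈ C, v ∈ e}

/-- `M(x)`: the edges of value `1`. -/
def matchedEdges (x : G.edgeSet → ℝ) : Set (Sym2 V) :=
  {e | ∃ h : e ∈ G.edgeSet, x ⟨e, h⟩ = 1}

/-- A cycle of `G` can be traversed starting from any of its vertices. -/
theorem exists_traverses {C : Finset (Sym2 V)} {u v : V} {c : G.Walk u u}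
    (hc : Traverses c C) (hv : v ∈ cycleVertices C) :
    ∃ d : G.Walk v v, Traverses d C := by
  obtain ⟨e, he, hve⟩ := hv
  obtain ⟨h1, rfl⟩ := hc
  have hs : v ∈ c.support := by
    rw [List.mem_toFinset] at he
    induction e with
    | _ a b =>
      rcases Sym2.mem_iff.1 hve with rfl | rfl
      · exact c.fst_mem_support_of_mem_edges he
      · exact c.snd_mem_support_of_mem_edges he
  refine ⟨c.rotate v hs, h1.rotate hs, ?_⟩
  ext f
  simp only [List.mem_toFinset]
  exact (c.rotate_edges v hs).mem_iff

end Support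

/-- `γ(G)`: the least number of odd cycles of a basic maximum-weight fractional matching. -/
noncomputable def gamma {V : Type*} [Fintype V] [DecidableEq V] (G : SimpleGraph V)
    [DecidableRel G.Adj] (w : G.edgeSet → ℝ) : ℕ :=
  sInf ((fun x => (oddCycles x).ncard) '' basicMaxFractionalMatchings G w)

section Paths

variable {V : Type*} {G : SimpleGraph V}

/-- The edges of the walk belong alternately to `M` and to its complement. -/
def Alternating (M : Set (Sym2 V)) {u v : V} (p : G.Walk u v) : Prop :=
  p.edges.IsChain (fun e f => e ∈ M ↔ f ∉ M)

/-- No edge of `M` is incident to `v`. -/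
def Exposed (M : Set (Sym2 V)) (v : V) : Prop := ∀ e ∈ M, v ∉ e

/-- The walk starts with an `M`-exposed vertex or an edge of `M`, and ends with an `M`-exposed
vertex or an edge of `M`. -/
def Valid (M : Set (Sym2 V)) {u v : V} (p : G.Walk u v) : Prop :=
  (Exposed M u ∨ ∃ e ∈ p.edges.head?, e ∈ M) ∧ (Exposed M v ∨ ∃ e ∈ p.edges.getLast?, e ∈ M)

/-- Every edge `ab` of the walk is tight: `y_a + y_b = w_{ab}`. -/
def Tight (w : G.edgeSet → ℝ) (y : V → ℝ) {u v : V} (p : G.Walk u v) : Prop :=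
  ∀ (a b : V) (h : G.Adj a b), s(a, b) ∈ p.edges → y a + y b = w ⟨s(a, b), h⟩

end Paths

section Operations

variable {V : Type*} [DecidableEq V] {G : SimpleGraph V}

/-- Complementing on the edges of a walk: `x_e` becomes `1 - x_e` there. -/
def complementOn {u v : V} (p : G.Walk u v) (x : G.edgeSet → ℝ) : G.edgeSet → ℝ :=
  fun e => if (e : Sym2 V) ∈ p.edges then 1 - x e else x e

/-- Alternate rounding along the closed walk `c = (e₁, …, e₂ₖ₊₁)` at `v`: the edges
`e₁, e₃, …, e₂ₖ₊₁` get value `0`, the edges `e₂, e₄, …, e₂ₖ` get value `1`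
(positions in the list are counted from `0`). -/
def alternateRound {v : V} (c : G.Walk v v) (x : G.edgeSet → ℝ) : G.edgeSet → ℝ :=
  fun e => if (e : Sym2 V) ∈ c.edges then
    (if Even (c.edges.idxOf (e : Sym2 V)) then 0 else 1) else x e

end Operations

section Structures

variable {V : Type*} [DecidableEq V] {G : SimpleGraph V}

/-- `v` is a vertex of the odd cycle `C ∈ 𝒞(x)` and `y_v = 0`. -/
def ZeroOnCycle (x : G.edgeSet → ℝ) (y : V → ℝ) (C : Finset (Sym2 V)) (v : V) : Prop :=
  C ∈ oddCycles x ∧ v ∈ cycleVertices C ∧ y v = 0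

/-- `P` is a tight `M(x)`-alternating path which connects two different odd cycles
`C, D ∈ 𝒞(x)`. -/
def CycleToCycle (w : G.edgeSet → ℝ) (x : G.edgeSet → ℝ) (y : V → ℝ) (C D : Finset (Sym2 V))
    {u v : V} (P : G.Walk u v) : Prop :=
  C ∈ oddCycles x ∧ D ∈ oddCycles x ∧ C ≠ D ∧ u ∈ cycleVertices C ∧ v ∈ cycleVertices D ∧
    P.IsPath ∧ Alternating (matchedEdges x) P ∧ Tight w y P

/-- `P` is a tight and valid `M(x)`-alternating path which connects an odd cycle `C ∈ 𝒞(x)` and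
a vertex `v` with `y_v = 0` which lies on no cycle of `𝒞(x)`. -/
def CycleToZero (w : G.edgeSet → ℝ) (x : G.edgeSet → ℝ) (y : V → ℝ) (C : Finset (Sym2 V))
    {u v : V} (P : G.Walk u v) : Prop :=
  C ∈ oddCycles x ∧ u ∈ cycleVertices C ∧ (∀ D ∈ oddCycles x, v ∉ cycleVertices D) ∧ y v = 0 ∧
    P.IsPath ∧ Alternating (matchedEdges x) P ∧ Valid (matchedEdges x) P ∧ Tight w y P

end Structures

end FractionalMatching

open FractionalMatching

/-! Complementary slackness (`slack_of_optimal`, `optimal_of_slack`) turns optimality into a local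
condition relative to `y`: the support of the matching is tight, and vertices with positive dual
value are saturated. Extreme points are exactly the half-integral vectors of `IsHalfIntegral`
(`isHalfIntegral_of_extreme`, `extreme_of_isHalfIntegral`). Each rounding operation is therefore
checked by following vertex loads and tight edges. Alternate rounding destroys one cycle and exposes
one of its vertices. Either that vertex has dual value zero, or complementing the path saturates it
again and moves the defect to the other end, which is the exposed vertex of a second cycle or a
vertex of dual value zero.

For existence, suppose that no cycle of `x` carries a vertex of dual value zero. Let `x'` be an
optimal extreme point with `gamma G w` odd cycles, and round all cycles of both, giving integral
matchings `z` and `z'`. By slackness an exposed vertex of positive dual value lies on a cycle, and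
each cycle has just one exposed vertex. So `z` exposes at least as many such vertices as `x` has
cycles, and `z'` at most as many as `x'` has, which is fewer. Walk from each of those of `z`
alternately along edges of `z'` and `z`. Distinct starts never share an even end, so by counting
some walk does not end, after an even number of steps, at a vertex of positive dual value exposed by
`z'` (`exists_zigzag_end`). All its edges are tight, since `y` is slack with both `x` and `x'`. Cut
at its last visit to the starting cycle, it either reaches another cycle of `x` or ends at a vertex
of dual value zero off all cycles (`exists_path_of_zigzag`). -/

namespace FractionalMatching

/-! ### Edge vectors, vertex loads and alternating perturbations along trails. -/

section EdgeVectors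

variable {V : Type*} {G : SimpleGraph V}

open Classical in
/-- Extension by zero of an edge vector to all unordered pairs. -/
noncomputable def extendZero (x : G.edgeSet → ℝ) (e : Sym2 V) : ℝ :=
  if h : e ∈ G.edgeSet then x ⟨e, h⟩ else 0

theorem extendZero_apply (x : G.edgeSet → ℝ) {e : Sym2 V} (h : e ∈ G.edgeSet) :
    extendZero x e = x ⟨e, h⟩ := dif_pos h

@[simp] theorem extendZero_coe (x : G.edgeSet → ℝ) (e : G.edgeSet) :
    extendZero x (e : Sym2 V) = x e := extendZero_apply x e.2

theorem alternating_getElem {α : Type*} {φ : α → ℝ} {l : List α}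
    (h : l.IsChain (fun e f => φ f = -φ e)) (i : ℕ) (hi : i < l.length) :
    φ l[i] = (-1 : ℝ) ^ i * φ (l[0]'(by omega)) := by
  induction i with
  | zero => simp
  | succ k ih => rw [List.isChain_iff_getElem.1 h k hi, ih (by omega), pow_succ]; ring

theorem fst_edge_eq {u v : V} {p : G.Walk u v} (hn : 0 < p.edges.length) :
    p.edges[0] = s(u, p.snd) := by
  simp [SimpleGraph.Walk.getElem_edges]

theorem last_edge_eq {u v : V} {p : G.Walk u v} (hn : 0 < p.edges.length) :
    p.edges[p.edges.length - 1] = s(p.penultimate, v) := by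
  rw [SimpleGraph.Walk.getElem_edges]
  have : 0 < p.length := by simpa using hn
  simp only [SimpleGraph.Walk.length_edges, Nat.sub_add_cancel this,
    SimpleGraph.Walk.getVert_length]

theorem alternating_last {u v : V} {p : G.Walk u v} (hn : ¬p.Nil)
    {φ : Sym2 V → ℝ} (hφ : p.edges.IsChain (fun e f => φ f = -φ e)) :
    φ s(p.penultimate, v) = (-1 : ℝ) ^ (p.length - 1) * φ s(u, p.snd) := by
  have h : 0 < p.edges.length := by
    rw [SimpleGraph.Walk.length_edges]
    exact SimpleGraph.Walk.not_nil_iff_lt_length.1 hn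
  have := alternating_getElem hφ (p.edges.length - 1) (by omega)
  rwa [last_edge_eq h, fst_edge_eq h, SimpleGraph.Walk.length_edges] at this

theorem alternating_eq_zero {u v : V} {p : G.Walk u v}
    {φ : Sym2 V → ℝ} (hφ : p.edges.IsChain (fun e f => φ f = -φ e))
    (h0 : φ s(u, p.snd) = 0) {e : Sym2 V} (he : e ∈ p.edges) : φ e = 0 := by
  obtain ⟨i, hi, rfl⟩ := List.mem_iff_getElem.1 he
  rw [alternating_getElem hφ i hi, fst_edge_eq (by omega), h0, mul_zero]

theorem isChain_of_idxOf {α : Type*} [DecidableEq α] {l : List α} (hl : l.Nodup) (ψ : ℕ → ℝ)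
    (hψ : ∀ i, ψ (i + 1) = -ψ i) : l.IsChain (fun e f => ψ (l.idxOf f) = -ψ (l.idxOf e)) := by
  rw [List.isChain_iff_getElem]
  intro i hi
  rw [hl.idxOf_getElem, hl.idxOf_getElem, hψ]

variable [DecidableEq V]

/-- Along a walk on which `φ` changes sign in each step, the contributions to all vertices other
than the two ends cancel. -/
theorem sum_incident_alternating {u v : V} (p : G.Walk u v) (hp : ¬p.Nil) (φ : Sym2 V → ℝ)
    (hφ : p.edges.IsChain (fun e f => φ f = -φ e)) (t : V) :
    (p.edges.map (fun e => if t ∈ e then φ e else 0)).sum =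
      (if t = u then φ s(u, p.snd) else 0) + (if t = v then φ s(p.penultimate, v) else 0) := by
  induction p with
  | nil => exact absurd SimpleGraph.Walk.Nil.nil hp
  | @cons a b c h q ih =>
    cases q with
    | nil =>
      have := h.ne
      by_cases h1 : t = a <;> by_cases h2 : t = b <;> simp_all
    | @cons _ d _ h' q' =>
      have hb := h.ne
      rw [SimpleGraph.Walk.edges_cons] at hφ
      have hc := hφ.tail
      simp only [List.tail_cons] at hc
      have hd : φ s(b, d) = - φ s(a, b) := by
        rw [SimpleGraph.Walk.edges_cons] at hφ
        exact (List.isChain_cons_cons.1 hφ).1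
      have := ih (by simp) hc
      rw [SimpleGraph.Walk.edges_cons, List.map_cons, List.sum_cons, this]
      simp only [SimpleGraph.Walk.snd_cons, SimpleGraph.Walk.penultimate_cons_cons, hd,
        Sym2.mem_iff]
      by_cases h1 : t = a <;> by_cases h2 : t = b <;> simp_all

variable [Fintype V] [DecidableRel G.Adj]

/-- The load `x(δ(t))` of the vertex `t`. -/
def load (x : G.edgeSet → ℝ) (t : V) : ℝ :=
  ∑ e ∈ Finset.univ.filter (fun e : G.edgeSet => t ∈ (e : Sym2 V)), x e

theorem load_add (x z : G.edgeSet → ℝ) (t : V) : load (x + z) t = load x t + load z t := by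
  simp [load, Finset.sum_add_distrib]

theorem load_smul (a : ℝ) (x : G.edgeSet → ℝ) (t : V) : load (a • x) t = a * load x t := by
  simp [load, Finset.mul_sum]

theorem load_eq_sum_ite (x : G.edgeSet → ℝ) (t : V) :
    load x t = ∑ e : G.edgeSet, if t ∈ (e : Sym2 V) then x e else 0 := by
  rw [load, Finset.sum_filter]

theorem sum_edgeSet_eq_list_sum {u v : V} {p : G.Walk u v} (hp : p.IsTrail) (g : Sym2 V → ℝ) :
    ∑ e : G.edgeSet, (if (e : Sym2 V) ∈ p.edges then g e else 0) = (p.edges.map g).sum := by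
  rw [← List.sum_toFinset g hp.edges_nodup,
    ← Finset.sum_subtype G.edgeFinset (by simp) (fun e => if e ∈ p.edges then g e else 0),
    ← Finset.sum_filter]
  congr 1
  ext e
  simp only [Finset.mem_filter, SimpleGraph.mem_edgeFinset, List.mem_toFinset,
    and_iff_right_iff_imp]
  exact fun h => p.edges_subset_edgeSet h

/-- The basic computation behind rounding, complementing and the extreme point arguments: an
alternating perturbation along a trail is felt only at its two ends. -/
theorem load_alternating {u v : V} {p : G.Walk u v} (hp : p.IsTrail) (hn : ¬p.Nil)
    {φ : Sym2 V → ℝ} (hφ : p.edges.IsChain (fun e f => φ f = -φ e)) (t : V) :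
    load (fun e : G.edgeSet => if (e : Sym2 V) ∈ p.edges then φ e else 0) t =
      (if t = u then φ s(u, p.snd) else 0) + (if t = v then φ s(p.penultimate, v) else 0) := by
  rw [← sum_incident_alternating p hn φ hφ, ← sum_edgeSet_eq_list_sum hp, load_eq_sum_ite]
  refine Finset.sum_congr rfl fun e _ => ?_
  split_ifs <;> rfl

theorem mem_load_ge {x : G.edgeSet → ℝ} (hx : ∀ e, 0 ≤ x e) {t : V} {e : G.edgeSet}
    (he : t ∈ (e : Sym2 V)) : x e ≤ load x t :=
  Finset.single_le_sum (fun f _ => hx f) (by simpa using he)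

theorem load_eq_of_pair {x : G.edgeSet → ℝ} {t : V} {e f : G.edgeSet} (hef : e ≠ f)
    (he : t ∈ (e : Sym2 V)) (hf : t ∈ (f : Sym2 V))
    (h : ∀ g : G.edgeSet, t ∈ (g : Sym2 V) → g ≠ e → g ≠ f → x g = 0) :
    load x t = x e + x f := by
  rw [load, ← Finset.sum_pair hef]
  refine (Finset.sum_subset (fun g hg => ?_) fun g hg hg' => ?_).symm
  · simp only [Finset.mem_insert, Finset.mem_singleton] at hg
    rcases hg with rfl | rfl <;> simpa
  · simp only [Finset.mem_insert, Finset.mem_singleton, not_or] at hg'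
    exact h g (by simpa using hg) hg'.1 hg'.2

theorem add_le_load {x : G.edgeSet → ℝ} (hx : ∀ e, 0 ≤ x e) {t : V} {e f : G.edgeSet}
    (hef : e ≠ f) (he : t ∈ (e : Sym2 V)) (hf : t ∈ (f : Sym2 V)) : x e + x f ≤ load x t := by
  rw [load, ← Finset.sum_pair hef]
  refine Finset.sum_le_sum_of_subset_of_nonneg (fun g hg => ?_) fun g _ _ => hx g
  simp only [Finset.mem_insert, Finset.mem_singleton] at hg
  rcases hg with rfl | rfl <;> simpa

theorem add_add_le_load {x : G.edgeSet → ℝ} (hx : ∀ e, 0 ≤ x e) {t : V} {e f g : G.edgeSet}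
    (hef : e ≠ f) (heg : e ≠ g) (hfg : f ≠ g) (he : t ∈ (e : Sym2 V)) (hf : t ∈ (f : Sym2 V))
    (hg : t ∈ (g : Sym2 V)) : x e + x f + x g ≤ load x t := by
  have : ∑ a ∈ {e, f, g}, x a = x e + x f + x g := by
    rw [Finset.sum_insert (by simp [hef, heg]), Finset.sum_pair hfg, add_assoc]
  rw [← this]
  refine Finset.sum_le_sum_of_subset_of_nonneg (fun a ha => ?_) fun g _ _ => hx g
  simp only [Finset.mem_insert, Finset.mem_singleton] at ha
  rcases ha with rfl | rfl | rfl <;> simpa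

end EdgeVectors

/-! ### Strong duality and complementary slackness. -/

section Duality

theorem le_zero_of_forall_lt {a b : ℝ} (h : ∀ ε > 0, a - ε * b < 0) : a ≤ 0 := by
  by_contra! ha
  have hb : 0 < |b| + 1 := by positivity
  have := h (a / (|b| + 1)) (by positivity)
  have h2 : a / (|b| + 1) * b ≤ a / (|b| + 1) * |b| :=
    mul_le_mul_of_nonneg_left (le_abs_self b) (by positivity)
  have h3 : a / (|b| + 1) * (|b| + 1) = a := by field_simp
  have h4 : 0 < a / (|b| + 1) := by positivity
  nlinarith

variable {V : Type*} [Fintype V] [DecidableEq V] {G : SimpleGraph V}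

theorem sum_mem_edge {a b : V} (h : a ≠ b) (y : V → ℝ) :
    ∑ v, (if v ∈ s(a, b) then y v else 0) = y a + y b := by
  rw [← Finset.sum_filter, ← Finset.sum_pair h]
  congr 1
  ext v
  simp

theorem cover_le {w : G.edgeSet → ℝ} {y : V → ℝ} (hy : y ∈ fractionalCovers G w)
    (e : G.edgeSet) : w e ≤ ∑ v, if v ∈ (e : Sym2 V) then y v else 0 := by
  obtain ⟨e, he⟩ := e
  induction e with
  | _ a b => exact (sum_mem_edge (G.ne_of_adj he) y).symm ▸ hy.2 a b he

variable [DecidableRel G.Adj]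

theorem sum_mul_load (x : G.edgeSet → ℝ) (y : V → ℝ) :
    ∑ v, y v * load x v =
      ∑ e : G.edgeSet, (∑ v, if v ∈ (e : Sym2 V) then y v else 0) * x e := by
  simp_rw [load_eq_sum_ite, Finset.mul_sum, Finset.sum_mul]
  rw [Finset.sum_comm]
  refine Finset.sum_congr rfl fun e _ => Finset.sum_congr rfl fun v _ => ?_
  split_ifs <;> simp

/-- The perturbed constraint and objective values which some nonnegative `z` strictly beats. -/
def strictValues (w : G.edgeSet → ℝ) (p : ℝ) : Set ((V → ℝ) × ℝ) :=
  {a | ∃ z : G.edgeSet → ℝ, (∀ e, 0 ≤ z e) ∧ (∀ v, load z v - 1 < a.1 v) ∧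
    a.2 < ∑ e, w e * z e - p}

theorem isOpen_strictValues (w : G.edgeSet → ℝ) (p : ℝ) : IsOpen (strictValues w p) := by
  have : strictValues w p = ⋃ z ∈ {z : G.edgeSet → ℝ | ∀ e, 0 ≤ z e},
      {a : (V → ℝ) × ℝ | (∀ v, load z v - 1 < a.1 v) ∧ a.2 < ∑ e, w e * z e - p} := by
    ext a; simp only [strictValues, Set.mem_iUnion, Set.mem_ofPred_eq, exists_prop]
  rw [this]
  refine isOpen_biUnion fun z _ => IsOpen.inter ?_ ?_
  · have : {a : (V → ℝ) × ℝ | ∀ v, load z v - 1 < a.1 v} =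
        ⋂ v, {a : (V → ℝ) × ℝ | load z v - 1 < a.1 v} := by ext; simp
    change IsOpen {a : (V → ℝ) × ℝ | ∀ v, load z v - 1 < a.1 v}
    rw [this]
    exact isOpen_iInter_of_finite fun v => isOpen_lt continuous_const (by fun_prop)
  · exact isOpen_lt continuous_snd continuous_const

theorem convex_strictValues (w : G.edgeSet → ℝ) (p : ℝ) : Convex ℝ (strictValues w p) := by
  rw [convex_iff_forall_pos]
  rintro a ⟨z, hz, h1, h2⟩ b ⟨z', hz', h1', h2'⟩ s t hs ht hst
  refine ⟨s • z + t • z', fun e => ?_, fun v => ?_, ?_⟩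
  · have := mul_nonneg hs.le (hz e)
    have := mul_nonneg ht.le (hz' e)
    simp only [Pi.add_apply, Pi.smul_apply, smul_eq_mul]
    linarith
  · have e1 := mul_lt_mul_of_pos_left (h1 v) hs
    have e2 := mul_lt_mul_of_pos_left (h1' v) ht
    rw [load_add, load_smul, load_smul]
    simp only [Prod.fst_add, Prod.smul_fst, Pi.add_apply, Pi.smul_apply, smul_eq_mul]
    linear_combination e1 + e2 + hst
  · have e1 := mul_lt_mul_of_pos_left h2 hs
    have e2 := mul_lt_mul_of_pos_left h2' ht
    have : ∑ e, w e * (s • z + t • z') e = s * ∑ e, w e * z e + t * ∑ e, w e * z' e := by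
      rw [Finset.mul_sum, Finset.mul_sum, ← Finset.sum_add_distrib]
      refine Finset.sum_congr rfl fun e _ => ?_
      simp only [Pi.add_apply, Pi.smul_apply, smul_eq_mul]; ring
    rw [this]
    simp only [Prod.snd_add, Prod.smul_snd, smul_eq_mul]
    linear_combination e1 + e2 - p * hst

theorem load_zero (t : V) : load (0 : G.edgeSet → ℝ) t = 0 := by simp [load]

/-- Strong duality for the fractional matching linear program. -/
theorem exists_cover_of_max {w : G.edgeSet → ℝ} {x : G.edgeSet → ℝ}
    (hx : x ∈ maxFractionalMatchings G w) :
    ∃ y ∈ fractionalCovers G w, ∑ v, y v ≤ ∑ e, w e * x e := by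
  obtain ⟨p, hp⟩ : ∃ p, ∑ e, w e * x e = p := ⟨_, rfl⟩
  rw [hp]
  have h0 : (0 : (V → ℝ) × ℝ) ∉ strictValues w p := by
    rintro ⟨z, hz, h1, h2⟩
    have := hx.2 z ⟨hz, fun v => by have := h1 v; simp only [Prod.fst_zero, Pi.zero_apply] at this
                                    exact (sub_neg.1 this).le⟩
    simp only [Prod.snd_zero] at h2
    linarith
  obtain ⟨f, hf⟩ := geometric_hahn_banach_open_point (convex_strictValues w p)
    (isOpen_strictValues w p) h0
  rw [map_zero] at hf
  -- The separating functional is `m * r - ∑ v, c v * s v`; the dual solution will be `c / m`.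
  set c : V → ℝ := fun v => -f (Pi.single v 1, 0) with hc
  set m : ℝ := f (0, 1) with hm
  have hfe : ∀ s r, f (s, r) = m * r - ∑ v, c v * s v := by
    intro s r
    have h1 : (s, r) = (LinearMap.inl ℝ (V → ℝ) ℝ) s + r • ((0 : V → ℝ), (1 : ℝ)) := by simp
    rw [h1, map_add, map_smul, smul_eq_mul, ← hm,
      show f ((LinearMap.inl ℝ (V → ℝ) ℝ) s) = (f.toLinearMap ∘ₗ LinearMap.inl ℝ (V → ℝ) ℝ) s
        from rfl, LinearMap.pi_apply_eq_sum_univ]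
    have : ∀ i, (fun j : V => if i = j then (1 : ℝ) else 0) = Pi.single i 1 := by
      intro i; ext j; simp [Pi.single_apply, eq_comm]
    simp only [this, hc]
    simp only [LinearMap.coe_comp, Function.comp_apply, LinearMap.inl_apply, smul_eq_mul,
      ContinuousLinearMap.coe_coe, neg_mul, Finset.sum_neg_distrib]
    rw [show ∑ i, s i * f (Pi.single i 1, 0) = ∑ i, f (Pi.single i 1, 0) * s i from
      Finset.sum_congr rfl fun i _ => mul_comm _ _]
    ring
  -- The zero matching satisfies every vertex constraint strictly, so it is a Slater point, which
  -- makes the objective multiplier positive.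
  have hm0 : 0 < m := by
    have := hf (0, -(|p| + 1)) ⟨0, fun _ => le_rfl, fun v => by simp [load_zero], by
      have := neg_abs_le p
      have := le_abs_self p
      simp; linarith⟩
    rw [hfe] at this
    simp only [Pi.zero_apply, mul_zero, Finset.sum_const_zero, sub_zero] at this
    have : 0 < |p| + 1 := by positivity
    nlinarith
  have hc0 : ∀ v, 0 ≤ c v := by
    intro v
    by_contra! hv
    -- Relaxing the constraint at `v` stays in the set; this amount makes the functional exactly
    -- `0`, where it should be negative.
    have h2 : 0 ≤ m * (|p| + 1) / (-c v) := div_nonneg (by positivity) (by linarith)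
    have := hf (Pi.single v (m * (|p| + 1) / (-c v)), -(|p| + 1)) ⟨0, fun _ => le_rfl, fun u => by
        rw [load_zero]
        simp only [Pi.single_apply]
        split_ifs <;> linarith, by
      have := neg_abs_le p
      have := le_abs_self p
      simp; linarith⟩
    rw [hfe] at this
    simp only [Pi.single_apply, mul_ite, mul_zero, Finset.sum_ite_eq', Finset.mem_univ,
      if_true] at this
    have h3 : c v * (m * (|p| + 1) / (-c v)) = - (m * (|p| + 1)) := by
      rw [← mul_div_assoc, div_neg, mul_div_cancel_left₀ _ hv.ne]
    rw [h3] at this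
    linarith
  have key : ∀ z : G.edgeSet → ℝ, (∀ e, 0 ≤ z e) →
      m * (∑ e, w e * z e - p) ≤ ∑ v, c v * (load z v - 1) := by
    intro z hz
    rw [← sub_nonpos]
    refine le_zero_of_forall_lt (b := ∑ v, c v + m) fun ε hε => ?_
    have := hf (fun v => load z v - 1 + ε, ∑ e, w e * z e - p - ε)
      ⟨z, hz, fun v => by simpa using hε, by simpa using hε⟩
    rw [hfe] at this
    simp only [mul_add, Finset.sum_add_distrib, ← Finset.sum_mul] at this
    linarith
  have keyy : ∀ z : G.edgeSet → ℝ, (∀ e, 0 ≤ z e) →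
      ∑ e, w e * z e - p ≤ ∑ v, c v / m * load z v - ∑ v, c v / m := by
    intro z hz
    have := key z hz
    rw [← Finset.sum_sub_distrib]
    have h1 : ∑ v, (c v / m * load z v - c v / m) = (∑ v, c v * (load z v - 1)) / m := by
      rw [Finset.sum_div]
      exact Finset.sum_congr rfl fun v _ => by ring
    rw [h1, le_div_iff₀ hm0]
    linarith
  refine ⟨fun v => c v / m, ⟨fun v => div_nonneg (hc0 v) hm0.le, fun a b h => ?_⟩, ?_⟩
  · by_contra! hlt
    set q := ∑ v, c v / m with hq
    set g := w ⟨s(a, b), h⟩ - (c a / m + c b / m) with hg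
    have hg0 : 0 < g := by linarith
    -- Weight `T` on one edge violated by `g` gains `g * T = |p - q| + 1`, more than the bound `p -
    -- q` allows.
    set T := (|p - q| + 1) / g with hT
    have hT0 : 0 < T := by positivity
    have := keyy (Pi.single ⟨s(a, b), h⟩ T) fun e => by
      simp only [Pi.single_apply]; split_ifs <;> [exact hT0.le; exact le_rfl]
    rw [sum_mul_load] at this
    simp only [Pi.single_apply, mul_ite, mul_zero, Finset.sum_ite_eq', Finset.mem_univ,
      if_true] at this
    rw [sum_mem_edge (G.ne_of_adj h)] at this
    have h2 : g * T = |p - q| + 1 := by rw [hT]; field_simp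
    have h3 := le_abs_self (p - q)
    have : (g + (c a / m + c b / m)) * T - p ≤ (c a / m + c b / m) * T - q := by
      rw [hg]; simpa using this
    linarith
  · have := keyy 0 fun _ => le_rfl
    simp only [load_zero] at this
    simp at this
    linarith

variable {w : G.edgeSet → ℝ} {x : G.edgeSet → ℝ} {y : V → ℝ}

/-- `x` and `y` satisfy the complementary slackness conditions. -/
def Slack (w : G.edgeSet → ℝ) (x : G.edgeSet → ℝ) (y : V → ℝ) : Prop :=
  (∀ (a b : V) (h : G.Adj a b), x ⟨s(a, b), h⟩ ≠ 0 → y a + y b = w ⟨s(a, b), h⟩) ∧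
    ∀ v, y v ≠ 0 → load x v = 1

/-- Weak duality is a chain of two termwise inequalities between `∑ e, w e * x e` and `∑ v, y v`.
Strong duality closes the chain, so equality holds in every term. -/
theorem slack_of_optimal (hx : x ∈ maxFractionalMatchings G w)
    (hy : y ∈ minFractionalCovers G w) : Slack w x y := by
  obtain ⟨y', hy', hle⟩ := exists_cover_of_max hx
  have h1 : ∑ v, y v ≤ ∑ e, w e * x e := (hy.2 y' hy').trans hle
  have h2 : ∀ e ∈ (Finset.univ : Finset G.edgeSet),
      w e * x e ≤ (∑ v, if v ∈ (e : Sym2 V) then y v else 0) * x e :=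
    fun e _ => mul_le_mul_of_nonneg_right (cover_le hy.1 e) (hx.1.1 e)
  have h3 : ∀ v ∈ (Finset.univ : Finset V), y v * load x v ≤ y v :=
    fun v _ => mul_le_of_le_one_right (hy.1.1 v) (hx.1.2 v)
  have h4 := Finset.sum_le_sum h2
  have h5 := Finset.sum_le_sum h3
  rw [sum_mul_load] at h5
  have h6 := (Finset.sum_eq_sum_iff_of_le h2).1 (by linarith)
  have h7 := (Finset.sum_eq_sum_iff_of_le h3).1 (by rw [sum_mul_load]; linarith)
  refine ⟨fun a b h hne => ?_, fun v hv => ?_⟩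
  · have := mul_right_cancel₀ hne (h6 ⟨s(a, b), h⟩ (Finset.mem_univ _))
    rw [this, sum_mem_edge (G.ne_of_adj h)]
  · exact (mul_eq_left₀ hv).1 (h7 v (Finset.mem_univ v))

theorem optimal_of_slack (hx : x ∈ fractionalMatchings G) (hy : y ∈ fractionalCovers G w)
    (h : Slack w x y) : x ∈ maxFractionalMatchings G w := by
  refine ⟨hx, fun z hz => ?_⟩
  have h1 : ∑ e, w e * x e = ∑ v, y v := by
    have : ∑ v, y v = ∑ v, y v * load x v := by
      refine Finset.sum_congr rfl fun v _ => ?_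
      by_cases hv : y v = 0
      · simp [hv]
      · rw [h.2 v hv, mul_one]
    rw [this, sum_mul_load]
    refine Finset.sum_congr rfl fun e _ => ?_
    by_cases he : x e = 0
    · simp [he]
    · obtain ⟨e, hE⟩ := e
      induction e with
      | _ a b => rw [sum_mem_edge (G.ne_of_adj hE), h.1 a b hE he]
  rw [h1]
  calc ∑ e, w e * z e ≤ ∑ e : G.edgeSet, (∑ v, if v ∈ (e : Sym2 V) then y v else 0) * z e :=
        Finset.sum_le_sum fun e _ => mul_le_mul_of_nonneg_right (cover_le hy e) (hz.1 e)
    _ = ∑ v, y v * load z v := (sum_mul_load z y).symm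
    _ ≤ ∑ v, y v := Finset.sum_le_sum fun v _ => mul_le_of_le_one_right (hy.1 v) (hz.2 v)

end Duality

/-! ### Half-integrality of extreme points. -/

section Structure

open Filter Topology

variable {V : Type*} {G : SimpleGraph V} {x : G.edgeSet → ℝ}

/-- The edges of fractional value. -/
def fracEdges (x : G.edgeSet → ℝ) : Set G.edgeSet := {e | 0 < x e ∧ x e < 1}

/-- The graph of the edges of fractional value. -/
def fracGraph (x : G.edgeSet → ℝ) : SimpleGraph V :=
  SimpleGraph.fromEdgeSet {e | ∃ h : e ∈ G.edgeSet, (⟨e, h⟩ : G.edgeSet) ∈ fracEdges x}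

theorem fracGraph_adj {a b : V} :
    (fracGraph x).Adj a b ↔ ∃ h : s(a, b) ∈ G.edgeSet, (⟨s(a, b), h⟩ : G.edgeSet) ∈ fracEdges x := by
  rw [fracGraph, SimpleGraph.fromEdgeSet_adj]
  exact ⟨fun h => h.1, fun h => ⟨h, G.ne_of_adj h.1⟩⟩

theorem fracGraph_le : fracGraph x ≤ G := fun _ _ h => (fracGraph_adj.1 h).1

variable [DecidableEq V]

theorem Traverses.two_edges {v : V} {c : G.Walk v v} {C : Finset (Sym2 V)} (h : Traverses c C) :
    ∃ e f : G.edgeSet, e ≠ f ∧ v ∈ (e : Sym2 V) ∧ v ∈ (f : Sym2 V) ∧ (e : Sym2 V) ∈ C ∧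
      (f : Sym2 V) ∈ C ∧ (e : Sym2 V) = s(v, c.snd) ∧ (f : Sym2 V) = s(c.penultimate, v) := by
  obtain ⟨hc, rfl⟩ := h
  have hn := hc.not_nil
  have he : s(v, c.snd) ∈ c.edges := SimpleGraph.Walk.mk_start_snd_mem_edges hn
  have hf : s(c.penultimate, v) ∈ c.edges := SimpleGraph.Walk.mk_penultimate_end_mem_edges hn
  refine ⟨⟨_, c.edges_subset_edgeSet he⟩, ⟨_, c.edges_subset_edgeSet hf⟩, ?_, by simp, by simp,
    by simpa, by simpa, rfl, rfl⟩
  intro hE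
  have h := congrArg Subtype.val hE
  exact hc.snd_ne_penultimate (Sym2.congr_right.1 (h.trans Sym2.eq_swap))

theorem exists_two_edges {C : Finset (Sym2 V)} (hC : C ∈ oddCycles x) {v : V}
    (hv : v ∈ cycleVertices C) :
    ∃ e f : G.edgeSet, e ≠ f ∧ v ∈ (e : Sym2 V) ∧ v ∈ (f : Sym2 V) ∧ (e : Sym2 V) ∈ C ∧
      (f : Sym2 V) ∈ C ∧ x e = 1 / 2 ∧ x f = 1 / 2 := by
  obtain ⟨⟨u, c, hc⟩, -, h⟩ := hC
  obtain ⟨d, hd⟩ := exists_traverses hc hv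
  obtain ⟨e, f, h1, h2, h3, h4, h5, -⟩ := hd.two_edges
  exact ⟨e, f, h1, h2, h3, h4, h5, h e h4, h f h5⟩

variable [Fintype V] [DecidableRel G.Adj]

theorem le_one_of_mem (hx : x ∈ fractionalMatchings G) (e : G.edgeSet) : x e ≤ 1 := by
  obtain ⟨e, he⟩ := e
  induction e with
  | _ a b => exact (mem_load_ge hx.1 (Sym2.mem_mk_left a b)).trans (hx.2 a)

theorem load_eq_one_of_cycle (hx : x ∈ fractionalMatchings G) {C : Finset (Sym2 V)}
    (hC : C ∈ oddCycles x) {v : V} (hv : v ∈ cycleVertices C) : load x v = 1 := by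
  obtain ⟨e, f, h1, h2, h3, -, -, h6, h7⟩ := exists_two_edges hC hv
  have := add_le_load hx.1 h1 h2 h3
  have h : load x v ≤ 1 := hx.2 v
  linarith

theorem eq_zero_of_two_halves (hx : x ∈ fractionalMatchings G) {v : V} {e f g : G.edgeSet}
    (hef : e ≠ f) (he : v ∈ (e : Sym2 V)) (hf : v ∈ (f : Sym2 V)) (hxe : x e = 1 / 2)
    (hxf : x f = 1 / 2) (hg : v ∈ (g : Sym2 V)) (hge : g ≠ e) (hgf : g ≠ f) : x g = 0 := by
  have := add_add_le_load hx.1 hef hge.symm hgf.symm he hf hg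
  have h : load x v ≤ 1 := hx.2 v
  have := hx.1 g
  linarith

theorem mem_cycle_of_ne_zero (hx : x ∈ fractionalMatchings G) {C : Finset (Sym2 V)}
    (hC : C ∈ oddCycles x) {v : V} (hv : v ∈ cycleVertices C) {g : G.edgeSet}
    (hg : v ∈ (g : Sym2 V)) (hxg : x g ≠ 0) : (g : Sym2 V) ∈ C := by
  obtain ⟨e, f, h1, h2, h3, h4, h5, h6, h7⟩ := exists_two_edges hC hv
  by_contra hn
  exact hxg (eq_zero_of_two_halves hx h1 h2 h3 h6 h7 hg (fun h => hn (h ▸ h4))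
    (fun h => hn (h ▸ h5)))

/-- Two edges of value `1/2` exhaust the load of a vertex of `D`, so walking along `C` from a common
vertex one can never leave `D`. -/
theorem cycle_subset (hx : x ∈ fractionalMatchings G) {C D : Finset (Sym2 V)}
    (hC : C ∈ oddCycles x) (hD : D ∈ oddCycles x) {v : V} (hv : v ∈ cycleVertices C)
    (hv' : v ∈ cycleVertices D) : C ⊆ D := by
  obtain ⟨⟨u, c', hc'⟩, -, h⟩ := hC
  obtain ⟨c, hc, rfl⟩ := exists_traverses hc' hv
  have hhalf : ∀ i (hi : i < c.edges.length), c.getVert i ∈ cycleVertices D →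
      s(c.getVert i, c.getVert (i + 1)) ∈ D := by
    intro i hi hiD
    have hm : c.edges[i] ∈ c.edges := List.getElem_mem hi
    rw [SimpleGraph.Walk.getElem_edges] at hm
    have := h ⟨_, c.edges_subset_edgeSet hm⟩ (by simpa using hm)
    exact mem_cycle_of_ne_zero (g := ⟨_, c.edges_subset_edgeSet hm⟩) hx hD hiD (by simp)
      (by rw [this]; norm_num)
  have hvert : ∀ i, i ≤ c.edges.length → c.getVert i ∈ cycleVertices D := by
    intro i
    induction i with
    | zero => intro _; simpa using hv'
    | succ k ih => exact fun hk => ⟨_, hhalf k hk (ih (by omega)), by simp⟩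
  intro e he
  obtain ⟨i, hi, rfl⟩ := List.mem_iff_getElem.1 (List.mem_toFinset.1 he)
  rw [SimpleGraph.Walk.getElem_edges]
  exact hhalf i hi (hvert i hi.le)

theorem cycle_eq (hx : x ∈ fractionalMatchings G) {C D : Finset (Sym2 V)}
    (hC : C ∈ oddCycles x) (hD : D ∈ oddCycles x) {v : V} (hv : v ∈ cycleVertices C)
    (hv' : v ∈ cycleVertices D) : C = D :=
  (cycle_subset hx hC hD hv hv').antisymm (cycle_subset hx hD hC hv' hv)

/-- A fractional matching whose support consists of edges of value `1` and of odd cycles all of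
whose edges have value `1/2`. -/
def IsHalfIntegral (x : G.edgeSet → ℝ) : Prop :=
  x ∈ fractionalMatchings G ∧
    ∀ e : G.edgeSet, x e = 0 ∨ x e = 1 ∨ ∃ C ∈ oddCycles x, (e : Sym2 V) ∈ C

theorem eventually_add_smul_mem (hx : x ∈ fractionalMatchings G) {d : G.edgeSet → ℝ}
    (hd : ∀ e, d e ≠ 0 → 0 < x e) (hl : ∀ v, load x v = 1 → load d v = 0) :
    ∀ᶠ ε : ℝ in 𝓝[>] 0, x + ε • d ∈ fractionalMatchings G := by
  have h1 : ∀ e, ∀ᶠ ε : ℝ in 𝓝[>] 0, 0 ≤ x e + ε * d e := by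
    intro e
    by_cases he : d e = 0
    · exact Eventually.of_forall fun _ => by simpa [he] using hx.1 e
    · have : Tendsto (fun ε : ℝ => x e + ε * d e) (𝓝[>] 0) (𝓝 (x e + 0 * d e)) :=
        (Continuous.tendsto (by fun_prop) 0).mono_left nhdsWithin_le_nhds
      exact (this.eventually (lt_mem_nhds (by simpa using hd e he))).mono fun _ h => h.le
  have h2 : ∀ v, ∀ᶠ ε : ℝ in 𝓝[>] 0, load x v + ε * load d v ≤ 1 := by
    intro v
    have hv : load x v ≤ 1 := hx.2 v
    rcases hv.lt_or_eq with hv' | hv'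
    · have : Tendsto (fun ε : ℝ => load x v + ε * load d v) (𝓝[>] 0)
          (𝓝 (load x v + 0 * load d v)) :=
        (Continuous.tendsto (by fun_prop) 0).mono_left nhdsWithin_le_nhds
      exact (this.eventually (gt_mem_nhds (by simpa using hv'))).mono fun _ h => h.le
    · exact Eventually.of_forall fun _ => by simpa [hl v hv'] using hv
  filter_upwards [eventually_all.2 h1, eventually_all.2 h2] with ε h1 h2
  refine ⟨fun e => by simpa using h1 e, fun v => ?_⟩
  have := h2 v
  rwa [← load_smul, ← load_add] at this

/-- An extreme point admits no nonzero direction that keeps all tight constraints tight. -/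
theorem eq_zero_of_extreme (hx : x ∈ (fractionalMatchings G).extremePoints ℝ)
    {d : G.edgeSet → ℝ} (hd : ∀ e, d e ≠ 0 → 0 < x e)
    (hl : ∀ v, load x v = 1 → load d v = 0) : d = 0 := by
  have h1 := eventually_add_smul_mem hx.1 hd hl
  have h2 := eventually_add_smul_mem (d := (-1 : ℝ) • d) hx.1 (fun e he => hd e (by simpa using he))
    (fun v hv => by rw [load_smul, hl v hv, mul_zero])
  obtain ⟨ε, ⟨h1, h2⟩, hε⟩ := ((h1.and h2).and self_mem_nhdsWithin).exists
  have := ((mem_extremePoints.1 hx).2 _ h1 _ h2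
    ⟨1 / 2, 1 / 2, by norm_num, by norm_num, by norm_num, by
      ext e; simp only [Pi.add_apply, Pi.smul_apply, smul_eq_mul]; ring⟩).1
  have h0 : ε • d = 0 := by simpa using this
  exact (smul_eq_zero.1 h0).resolve_left (ne_of_gt hε)

/-- A single fractional edge cannot saturate a vertex, and any other edge of positive value there is
itself fractional. -/
theorem exists_frac_ne (hx : x ∈ fractionalMatchings G) {v : V} (hv : load x v = 1)
    {e : G.edgeSet} (he : e ∈ fracEdges x) (hve : v ∈ (e : Sym2 V)) :
    ∃ f ∈ fracEdges x, f ≠ e ∧ v ∈ (f : Sym2 V) := by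
  by_contra! hcon
  have : load x v = x e := by
    refine Finset.sum_eq_single_of_mem e (by simpa using hve) fun f hf hfe => ?_
    have hvf : v ∈ (f : Sym2 V) := by simpa using hf
    by_contra h0
    have hpos : 0 < x f := lt_of_le_of_ne (hx.1 f) (Ne.symm h0)
    have := add_le_load hx.1 hfe hvf hve
    have := he.1
    exact hcon f ⟨hpos, by linarith⟩ hfe hvf
  have := he.2
  linarith

open Classical in
/-- At an extreme point there are at most as many fractional edges as saturated vertices incident
to them. -/
theorem card_fracEdges_le (hx : x ∈ (fractionalMatchings G).extremePoints ℝ) :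
    (Finset.univ.filter (fun e : G.edgeSet => e ∈ fracEdges x)).card ≤
      (Finset.univ.filter (fun v : V => load x v = 1 ∧
        ∃ e ∈ fracEdges x, v ∈ (e : Sym2 V))).card := by
  set F := Finset.univ.filter (fun e : G.edgeSet => e ∈ fracEdges x) with hF
  set T := Finset.univ.filter (fun v : V => load x v = 1 ∧
        ∃ e ∈ fracEdges x, v ∈ (e : Sym2 V)) with hT
  let ex : (F → ℝ) → (G.edgeSet → ℝ) := fun z e => if h : e ∈ F then z ⟨e, h⟩ else 0
  have hadd : ∀ z z', ex (z + z') = ex z + ex z' := by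
    intro z z'; ext e; by_cases h : e ∈ F <;> simp [ex, h]
  have hsmul : ∀ (a : ℝ) z, ex (a • z) = a • ex z := by
    intro a z; ext e; by_cases h : e ∈ F <;> simp [ex, h]
  let f : (F → ℝ) →ₗ[ℝ] (T → ℝ) :=
    { toFun := fun z v => load (ex z) v
      map_add' := fun z z' => by ext v; simp [hadd, load_add]
      map_smul' := fun a z => by ext v; simp [hsmul, load_smul] }
  -- A vector in the kernel is a direction on the fractional edges that keeps every saturated vertex
  -- saturated; saturated vertices outside `T` meet no fractional edge.
  have hinj : Function.Injective f := by
    rw [← LinearMap.ker_eq_bot, LinearMap.ker_eq_bot']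
    intro z hz
    have h0 : ex z = 0 := by
      refine eq_zero_of_extreme hx (fun e he => ?_) fun v hv => ?_
      · by_contra hn
        have : e ∉ F := fun h => hn (Finset.mem_filter.1 h).2.1
        exact he (by simp [ex, this])
      · by_cases hvT : v ∈ T
        · exact congrFun hz ⟨v, hvT⟩
        · refine Finset.sum_eq_zero fun e he => ?_
          have : e ∉ F := fun h => hvT (by
            simp only [hT, Finset.mem_filter, Finset.mem_univ, true_and]
            exact ⟨hv, e, (Finset.mem_filter.1 h).2, by simpa using he⟩)
          simp [ex, this]
    ext ⟨e, he⟩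
    have := congrFun h0 e
    simpa [ex, he] using this
  have := LinearMap.finrank_le_finrank_of_injective hinj
  simpa using this

-- Double counting: each vertex of `T` has at least two fractional edges, while the fractional
-- degrees sum to `2 * F.card ≤ 2 * T.card`. Hence each degree is exactly `2` on `T` and `0`
-- elsewhere.
open Classical in
theorem tight_of_frac (hx : x ∈ (fractionalMatchings G).extremePoints ℝ) {v : V} {e : G.edgeSet}
    (he : e ∈ fracEdges x) (hv : v ∈ (e : Sym2 V)) :
    load x v = 1 ∧ load (fun e => if e ∈ fracEdges x then (1 : ℝ) else 0) v = 2 := by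
  set F := Finset.univ.filter (fun e : G.edgeSet => e ∈ fracEdges x) with hF
  set T := Finset.univ.filter (fun v : V => load x v = 1 ∧
        ∃ e ∈ fracEdges x, v ∈ (e : Sym2 V)) with hT
  set κ : G.edgeSet → ℝ := fun e => if e ∈ fracEdges x then (1 : ℝ) else 0 with hκ
  have hκ0 : ∀ e, 0 ≤ κ e := fun e => by simp only [hκ]; split_ifs <;> norm_num
  have hle : ∀ v ∈ (Finset.univ : Finset V), (if v ∈ T then (2 : ℝ) else 0) ≤ load κ v := by
    intro v _
    split_ifs with hvT
    · simp only [hT, Finset.mem_filter, Finset.mem_univ, true_and] at hvT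
      obtain ⟨h1, e, he, hve⟩ := hvT
      obtain ⟨f, hf, hfe, hvf⟩ := exists_frac_ne hx.1 h1 he hve
      have := add_le_load hκ0 hfe hvf hve
      simp only [hκ, he, hf, if_true] at this ⊢
      linarith
    · exact Finset.sum_nonneg fun e _ => hκ0 e
  have hsum : ∑ v, load κ v = 2 * F.card := by
    have := sum_mul_load κ (fun _ => 1)
    simp only [one_mul] at this
    rw [this]
    have h2 : ∀ e : G.edgeSet, (∑ v, if v ∈ (e : Sym2 V) then (1 : ℝ) else 0) = 2 := by
      rintro ⟨e, he⟩
      induction e with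
      | _ a b =>
        have := sum_mem_edge (G.ne_of_adj he) (fun _ => 1)
        norm_num at this ⊢
        exact this
    simp only [h2, ← Finset.mul_sum]
    simp [hκ, hF]
  have hsum' : ∑ v, (if v ∈ T then (2 : ℝ) else 0) = 2 * T.card := by
    simp [mul_comm]
  have hcard : (F.card : ℝ) ≤ T.card := by exact_mod_cast card_fracEdges_le hx
  have heq := (Finset.sum_eq_sum_iff_of_le hle).1
    (le_antisymm (Finset.sum_le_sum hle) (by rw [hsum, hsum']; linarith)) v (Finset.mem_univ v)
  have h1 : 1 ≤ load κ v := by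
    have := mem_load_ge hκ0 hv
    simpa [hκ, he] using this
  split_ifs at heq with hvT
  · exact ⟨(Finset.mem_filter.1 hvT).2.1, heq.symm⟩
  · linarith

theorem eq_half_of_frac (hx : x ∈ (fractionalMatchings G).extremePoints ℝ) {e : G.edgeSet}
    (he : e ∈ fracEdges x) : x e = 1 / 2 := by
  classical
  set κ : G.edgeSet → ℝ := fun e => if e ∈ fracEdges x then (1 : ℝ) else 0 with hκ
  -- At a saturated vertex with fractional edges, these are two in number and sum to `1`, so the
  -- deviation from `1/2` is an admissible direction.
  have h0 : (fun e => κ e * (x e - 1 / 2)) = 0 := by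
    refine eq_zero_of_extreme hx (fun e he => ?_) fun v hv => ?_
    · by_contra hn
      exact he (by simp [hκ, show e ∉ fracEdges x from fun h => hn h.1])
    · by_cases hvT : ∃ e ∈ fracEdges x, v ∈ (e : Sym2 V)
      · obtain ⟨e, he, hve⟩ := hvT
        have h2 := (tight_of_frac hx he hve).2
        have : load (fun e => κ e * (x e - 1 / 2)) v = load x v - 1 / 2 * load κ v := by
          simp only [load, Finset.mul_sum, ← Finset.sum_sub_distrib]
          refine Finset.sum_congr rfl fun g hg => ?_
          have hvg : v ∈ (g : Sym2 V) := by simpa using hg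
          by_cases hgF : g ∈ fracEdges x
          · simp [hκ, hgF]
          · have : x g = 0 := by
              by_contra hne
              have hpos := lt_of_le_of_ne (hx.1.1 g) (Ne.symm hne)
              have hge : g ≠ e := fun h => hgF (h ▸ he)
              have := add_le_load hx.1.1 hge hvg hve
              have := he.1
              exact hgF ⟨hpos, by linarith⟩
            simp [hκ, hgF, this]
        rw [this, hv, h2]; norm_num
      · push Not at hvT
        refine Finset.sum_eq_zero fun e he => ?_
        have : e ∉ fracEdges x := fun h => hvT e h (by simpa using he)
        simp [hκ, this]
  have := congrFun h0 e
  simp only [hκ, he, if_true, one_mul, Pi.zero_apply] at this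
  linarith

theorem fracGraph_isCycles (hx : x ∈ (fractionalMatchings G).extremePoints ℝ) :
    (fracGraph x).IsCycles := by
  rintro v ⟨a, ha⟩
  obtain ⟨haG, haF⟩ := fracGraph_adj.1 ha
  obtain ⟨⟨f, hfG⟩, hf, hfe, hvf⟩ := exists_frac_ne hx.1
    (tight_of_frac hx haF (Sym2.mem_mk_left v a)).1 haF (Sym2.mem_mk_left v a)
  obtain ⟨b, rfl⟩ := hvf
  have hab : a ≠ b := fun h => hfe (by subst h; rfl)
  have : (fracGraph x).neighborSet v = {a, b} := by
    ext c
    simp only [SimpleGraph.mem_neighborSet, Set.mem_insert_iff, Set.mem_singleton_iff]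
    constructor
    · intro hc
      obtain ⟨hcG, hcF⟩ := fracGraph_adj.1 hc
      by_contra! hn
      have h0 := eq_zero_of_two_halves hx.1 hfe (Sym2.mem_mk_left v b) (Sym2.mem_mk_left v a)
        (eq_half_of_frac hx hf) (eq_half_of_frac hx haF) (g := ⟨s(v, c), hcG⟩)
        (Sym2.mem_mk_left v c)
        (fun h => hn.2 (Sym2.congr_right.1 (congrArg Subtype.val h)))
        (fun h => hn.1 (Sym2.congr_right.1 (congrArg Subtype.val h)))
      exact (hcF.1.ne' h0)
    · rintro (rfl | rfl)
      · exact ha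
      · exact fracGraph_adj.2 ⟨hfG, hf⟩
  rw [this, Set.ncard_pair hab]

/-- Extreme points of the fractional matching polytope are half-integral. -/
theorem isHalfIntegral_of_extreme (hx : x ∈ (fractionalMatchings G).extremePoints ℝ) :
    IsHalfIntegral x := by
  refine ⟨hx.1, fun e => ?_⟩
  by_cases he : e ∈ fracEdges x
  · right; right
    obtain ⟨e, heG⟩ := e
    induction e with
    | _ a b =>
    have hadj : (fracGraph x).Adj a b := fracGraph_adj.2 ⟨heG, he⟩
    obtain ⟨u, p, hp, hep⟩ := SimpleGraph.adj_and_reachable_delete_edges_iff_exists_cycle.1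
      ⟨hadj, (fracGraph_isCycles hx).reachable_deleteEdges hadj⟩
    have hFp : ∀ f (hf : f ∈ p.edges), ∃ h : f ∈ G.edgeSet, (⟨f, h⟩ : G.edgeSet) ∈ fracEdges x := by
      intro f hf
      have := p.edges_subset_edgeSet hf
      induction f with
      | _ a b => exact fracGraph_adj.1 this
    set c := p.mapLe fracGraph_le with hc
    have hce : c.edges = p.edges := SimpleGraph.Walk.edges_mapLe_eq_edges _ _
    have hcyc : c.IsCycle := (SimpleGraph.Walk.isCycle_mapLe _).2 hp
    have hodd : Odd c.length := by
      by_contra heven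
      -- On an even cycle the alternating `±1` vector has load zero everywhere, which an extreme
      -- point excludes.
      rw [Nat.not_odd_iff_even] at heven
      have hchain := isChain_of_idxOf hcyc.1.1.edges_nodup (fun i => (-1 : ℝ) ^ i)
        (fun i => by rw [pow_succ]; ring)
      have h0 := eq_zero_of_extreme hx
        (d := fun e => if (e : Sym2 V) ∈ c.edges then (-1 : ℝ) ^ c.edges.idxOf (e : Sym2 V) else 0)
        (fun f hf => by
          have : (f : Sym2 V) ∈ c.edges := by by_contra h; exact hf (by simp [h])
          exact (hFp f (hce ▸ this)).2.1)
        (fun v _ => by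
          rw [load_alternating hcyc.1.1 hcyc.not_nil hchain v, alternating_last hcyc.not_nil hchain]
          have h3 := hcyc.three_le_length
          have : Odd (c.length - 1) := by
            rw [← Nat.not_even_iff_odd]
            grind
          rw [this.neg_one_pow]
          split_ifs <;> ring)
      have := congrFun h0 ⟨s(a, b), heG⟩
      simp [hce, hep] at this
    refine ⟨c.edges.toFinset, ⟨⟨u, c, hcyc, rfl⟩, ?_, fun f hf => ?_⟩, by simpa [hce] using hep⟩
    · rwa [List.toFinset_card_of_nodup hcyc.1.1.edges_nodup, SimpleGraph.Walk.length_edges]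
    · obtain ⟨_, h⟩ := hFp f (by simpa [hce] using hf)
      exact eq_half_of_frac hx h
  · by_cases h0 : x e = 0
    · exact Or.inl h0
    · refine Or.inr (Or.inl (le_antisymm (le_one_of_mem hx.1 e) ?_))
      by_contra! h
      exact he ⟨lt_of_le_of_ne (hx.1.1 e) (Ne.symm h0), h⟩

end Structure

/-! ### Alternate rounding and complementing preserve optimality. -/

section Operations

variable {V : Type*} {G : SimpleGraph V} {x : G.edgeSet → ℝ}

theorem extendZero_eq_one_iff {e : Sym2 V} : extendZero x e = 1 ↔ e ∈ matchedEdges x := by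
  unfold extendZero matchedEdges
  by_cases h : e ∈ G.edgeSet <;> simp [h]

/-- The values of `x` along a walk are `0, 1, 0, 1, …`. -/
def ZeroOneAlong (x : G.edgeSet → ℝ) {u v : V} (p : G.Walk u v) : Prop :=
  ∀ i (hi : i < p.edges.length), extendZero x p.edges[i] = if Even i then 0 else 1

theorem ZeroOneAlong.zero_or_one {u v : V} {p : G.Walk u v} (h : ZeroOneAlong x p) {e : G.edgeSet}
    (he : (e : Sym2 V) ∈ p.edges) : x e = 0 ∨ x e = 1 := by
  obtain ⟨i, hi, hie⟩ := List.mem_iff_getElem.1 he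
  have := h i hi
  rw [hie, extendZero_coe] at this
  rw [this]
  split_ifs <;> simp

variable [DecidableEq V]

theorem Traverses.mem_edges_iff {v : V} {c : G.Walk v v} {C : Finset (Sym2 V)}
    (hc : Traverses c C) {e : Sym2 V} : e ∈ c.edges ↔ e ∈ C := by
  rw [← hc.2, List.mem_toFinset]

theorem Traverses.mem_cycleVertices {v : V} {c : G.Walk v v} {C : Finset (Sym2 V)}
    (hc : Traverses c C) : v ∈ cycleVertices C := by
  obtain ⟨e, -, -, he, -, heC, -⟩ := hc.two_edges
  exact ⟨e, heC, he⟩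

theorem oddCycles_complementOn {u v : V} (p : G.Walk u v) :
    oddCycles (complementOn p x) = oddCycles x := by
  have : ∀ e : G.edgeSet, complementOn p x e = 1 / 2 ↔ x e = 1 / 2 := by
    intro e
    simp only [complementOn]
    split_ifs
    · constructor <;> intro _ <;> linarith
    · rfl
  simp only [oddCycles, this]

theorem tight_complementOn {w : G.edgeSet → ℝ} {y : V → ℝ}
    (h : ∀ (a b : V) (h : G.Adj a b), x ⟨s(a, b), h⟩ ≠ 0 → y a + y b = w ⟨s(a, b), h⟩)
    {u v : V} {p : G.Walk u v} (hp : Tight w y p) (a b : V)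
    (hab : G.Adj a b) (hne : complementOn p x ⟨s(a, b), hab⟩ ≠ 0) :
    y a + y b = w ⟨s(a, b), hab⟩ := by
  by_cases he : s(a, b) ∈ p.edges
  · exact hp a b hab he
  · exact h a b hab (by simpa [complementOn, he] using hne)

/-- The deviation from `1/2` changes sign from edge to edge. Around an odd cycle the first and last
edges have equal deviation, yet it must also be opposite at the base vertex, so it vanishes. -/
theorem cycle_edge_eq_half {z : G.edgeSet → ℝ} {C : Finset (Sym2 V)} (hodd : Odd C.card) {v : V}
    {c : G.Walk v v} (hc : Traverses c C)
    (h : ∀ (t : V) (e f : G.edgeSet), e ≠ f → t ∈ (e : Sym2 V) → t ∈ (f : Sym2 V) →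
      (e : Sym2 V) ∈ C → (f : Sym2 V) ∈ C → z e + z f = 1)
    {e : G.edgeSet} (he : (e : Sym2 V) ∈ C) : z e = 1 / 2 := by
  obtain ⟨a, b, hab, hva, hvb, haC, hbC, ha, hb⟩ := hc.two_edges
  obtain ⟨hcyc, rfl⟩ := hc
  simp only [List.mem_toFinset] at h he haC hbC
  rw [List.toFinset_card_of_nodup hcyc.1.1.edges_nodup, SimpleGraph.Walk.length_edges] at hodd
  set φ : Sym2 V → ℝ := fun E => extendZero z E - 1 / 2 with hφ
  have hchain : c.edges.IsChain (fun e f => φ f = -φ e) := by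
    rw [List.isChain_iff_getElem]
    intro i hi
    have h1 : c.edges[i] ∈ c.edges := List.getElem_mem _
    have h2 : c.edges[i + 1] ∈ c.edges := List.getElem_mem _
    have hne : c.edges[i] ≠ c.edges[i + 1] := fun hE => by
      have := (hcyc.1.1.edges_nodup.getElem_inj_iff).1 hE
      omega
    have := h (c.getVert (i + 1)) ⟨_, c.edges_subset_edgeSet h1⟩ ⟨_, c.edges_subset_edgeSet h2⟩
      (fun hE => hne (congrArg Subtype.val hE)) (by simp [SimpleGraph.Walk.getElem_edges])
      (by simp [SimpleGraph.Walk.getElem_edges]) h1 h2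
    rw [← extendZero_apply z, ← extendZero_apply z] at this
    simp only [hφ]
    linarith
  have hlast := alternating_last hcyc.not_nil hchain
  have heven : Even (c.length - 1) := by
    have := hcyc.three_le_length
    grind
  rw [heven.neg_one_pow, one_mul, ← ha, ← hb] at hlast
  have hsum := h v a b hab hva hvb haC hbC
  simp only [hφ, extendZero_coe] at hlast
  have hfirst : φ s(v, c.snd) = 0 := by
    simp only [hφ, ← ha, extendZero_coe]
    linarith
  have := alternating_eq_zero hchain hfirst he
  simp only [hφ, extendZero_coe] at this
  linarith

theorem alternateRound_of_notMem {v : V} {c : G.Walk v v} {C : Finset (Sym2 V)}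
    (hc : Traverses c C) {e : G.edgeSet} (he : (e : Sym2 V) ∉ C) : alternateRound c x e = x e := by
  rw [← hc.mem_edges_iff] at he
  simp [alternateRound, he]

theorem alternateRound_of_mem {v : V} {c : G.Walk v v} {C : Finset (Sym2 V)}
    (hc : Traverses c C) {e : G.edgeSet} (he : (e : Sym2 V) ∈ C) :
    alternateRound c x e = 0 ∨ alternateRound c x e = 1 := by
  rw [← hc.mem_edges_iff] at he
  simp only [alternateRound, he, if_true]
  split_ifs <;> simp

theorem ZeroOneAlong.alternateRound {u v t : V} {p : G.Walk u v} (h : ZeroOneAlong x p)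
    {C : Finset (Sym2 V)} (hC : C ∈ oddCycles x) {c : G.Walk t t} (hc : Traverses c C) :
    ZeroOneAlong (alternateRound c x) p := by
  intro i hi
  have hm : p.edges[i] ∈ p.edges := List.getElem_mem hi
  rw [← h i hi, extendZero_apply _ (p.edges_subset_edgeSet hm),
    extendZero_apply _ (p.edges_subset_edgeSet hm), alternateRound_of_notMem hc]
  intro hmC
  have h1 := hC.2.2 ⟨_, p.edges_subset_edgeSet hm⟩ hmC
  rcases h.zero_or_one (e := ⟨_, p.edges_subset_edgeSet hm⟩) hm with h' | h' <;>
    rw [h'] at h1 <;> norm_num at h1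

theorem tight_alternateRound {w : G.edgeSet → ℝ} {y : V → ℝ}
    (h : ∀ (a b : V) (h : G.Adj a b), x ⟨s(a, b), h⟩ ≠ 0 →
      y a + y b = w ⟨s(a, b), h⟩) {C : Finset (Sym2 V)} (hC : C ∈ oddCycles x) {v : V}
    {c : G.Walk v v} (hc : Traverses c C) (a b : V) (hab : G.Adj a b)
    (hne : alternateRound c x ⟨s(a, b), hab⟩ ≠ 0) : y a + y b = w ⟨s(a, b), hab⟩ := by
  refine h a b hab ?_
  by_cases he : s(a, b) ∈ C
  · rw [hC.2.2 ⟨_, hab⟩ he]; norm_num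
  · rwa [alternateRound_of_notMem hc he] at hne

variable [Fintype V] [DecidableRel G.Adj]

/-- Half-integral fractional matchings are extreme points of the fractional matching polytope. -/
theorem extreme_of_isHalfIntegral (hx : IsHalfIntegral x) :
    x ∈ (fractionalMatchings G).extremePoints ℝ := by
  refine mem_extremePoints_iff_left.2 ⟨hx.1, fun z hz z' hz' ⟨a, b, ha, hb, hab, hE⟩ => ?_⟩
  have he : ∀ e, a * z e + b * z' e = x e := fun e => by
    simpa using congrFun hE e
  -- In a convex combination equal to `x`, every constraint tight at `x` is tight at `z`. These
  -- equations determine `z`: directly on edges of value `0` or `1`, and by `cycle_edge_eq_half` on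
  -- the odd cycles.
  have h0 : ∀ e, x e = 0 → z e = 0 := by
    intro e h
    have h1 := he e
    have h2 := mul_nonneg hb.le (hz'.1 e)
    have h3 := mul_nonneg ha.le (hz.1 e)
    have : a * z e = 0 := by linarith
    exact (mul_eq_zero.1 this).resolve_left ha.ne'
  have hone : ∀ s t : ℝ, s ≤ 1 → t ≤ 1 → a * s + b * t = 1 → s = 1 := by
    intro s t hs ht h
    have h1 := mul_le_mul_of_nonneg_left ht hb.le
    refine le_antisymm hs (le_of_mul_le_mul_left ?_ ha)
    linarith
  have hl : ∀ v, load x v = 1 → load z v = 1 := by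
    intro v hv
    refine hone (load z v) (load z' v) (hz.2 v) (hz'.2 v) ?_
    rw [← load_smul, ← load_smul, ← load_add, hE, hv]
  ext e
  rcases hx.2 e with h | h | ⟨C, hC, heC⟩
  · rw [h0 e h, h]
  · rw [h, hone _ _ (le_one_of_mem hz e) (le_one_of_mem hz' e) ((he e).trans h)]
  · obtain ⟨⟨v, c, hc⟩, hodd, hhalf⟩ := id hC
    rw [hhalf e heC]
    refine cycle_edge_eq_half hodd hc (fun t f g hfg hf hg hfC hgC => ?_) heC
    rw [← load_eq_of_pair hfg hf hg fun k hk hkf hkg => h0 k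
      (eq_zero_of_two_halves hx.1 hfg hf hg (hhalf f hfC) (hhalf g hgC) hk hkf hkg)]
    exact hl t (load_eq_one_of_cycle hx.1 hC ⟨f, hfC, hf⟩)

theorem mem_basic_of_slack {w : G.edgeSet → ℝ} {y : V → ℝ} (hx : IsHalfIntegral x)
    (hy : y ∈ fractionalCovers G w) (h : Slack w x y) : x ∈ basicMaxFractionalMatchings G w :=
  ⟨extreme_of_isHalfIntegral hx, optimal_of_slack hx.1 hy h⟩

theorem load_alternateRound (hx : x ∈ fractionalMatchings G) {C : Finset (Sym2 V)}
    (hC : C ∈ oddCycles x) {v : V} {c : G.Walk v v} (hc : Traverses c C) (t : V) :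
    load (alternateRound c x) t = if t = v then 0 else load x t := by
  have hcyc := hc.1
  -- Rounding adds `-1/2` and `1/2` alternately. On an odd cycle both edges at `v` get `-1/2`, so
  -- only the load of `v` changes, by `-1`.
  have hchain := isChain_of_idxOf hcyc.1.1.edges_nodup
    (fun i => if Even i then -(1 / 2 : ℝ) else 1 / 2) (fun i => by
      by_cases h : Even i <;> simp [Nat.even_add_one, h])
  have hadd : alternateRound c x = x + fun e : G.edgeSet => if (e : Sym2 V) ∈ c.edges then
      (fun E => if Even (c.edges.idxOf E) then -(1 / 2 : ℝ) else 1 / 2) (e : Sym2 V) else 0 := by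
    ext e
    simp only [alternateRound, Pi.add_apply]
    split_ifs with h1 h2
    · rw [hC.2.2 e (hc.mem_edges_iff.1 h1)]; norm_num
    · rw [hC.2.2 e (hc.mem_edges_iff.1 h1)]; norm_num
    · simp
  have hlen : 0 < c.edges.length := by
    rw [SimpleGraph.Walk.length_edges]
    exact SimpleGraph.Walk.not_nil_iff_lt_length.1 hcyc.not_nil
  have hfirst : c.edges.idxOf s(v, c.snd) = 0 := by
    rw [← fst_edge_eq hlen, hcyc.1.1.edges_nodup.idxOf_getElem]
  have heven : Even (c.length - 1) := by
    have hodd := hC.2.1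
    rw [← hc.2, List.toFinset_card_of_nodup hcyc.1.1.edges_nodup,
      SimpleGraph.Walk.length_edges] at hodd
    have := hcyc.three_le_length
    grind
  have hl := load_alternating hcyc.1.1 hcyc.not_nil hchain t
  rw [alternating_last hcyc.not_nil hchain, heven.neg_one_pow, hfirst] at hl
  rw [hadd, load_add, hl]
  by_cases h : t = v
  · subst h
    rw [load_eq_one_of_cycle hx hC hc.mem_cycleVertices]
    norm_num
  · simp [h]

theorem oddCycles_alternateRound (hx : x ∈ fractionalMatchings G) {C : Finset (Sym2 V)}
    (hC : C ∈ oddCycles x) {v : V} {c : G.Walk v v} (hc : Traverses c C) :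
    oddCycles (alternateRound c x) = oddCycles x \ {C} := by
  have hhalf : ∀ e : G.edgeSet, alternateRound c x e = 1 / 2 → (e : Sym2 V) ∉ C := by
    intro e h he
    rcases alternateRound_of_mem (x := x) hc he with h' | h' <;> rw [h'] at h <;> norm_num at h
  ext D
  constructor
  · rintro ⟨hD, hodd, h⟩
    refine ⟨⟨hD, hodd, fun e he => ?_⟩, ?_⟩
    · rw [← alternateRound_of_notMem (x := x) hc (hhalf e (h e he)), h e he]
    · rintro rfl
      obtain ⟨e, -, -, he, -, heC, -⟩ := hc.two_edges
      exact hhalf e (h e heC) heC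
  · rintro ⟨hD, hDC⟩
    refine ⟨hD.1, hD.2.1, fun e he => ?_⟩
    rw [alternateRound_of_notMem hc, hD.2.2 e he]
    intro heC
    obtain ⟨e, hE⟩ := e
    induction e with
    | _ a b => exact hDC (cycle_eq hx hD hC ⟨_, he, Sym2.mem_mk_left a b⟩
        ⟨_, heC, Sym2.mem_mk_left a b⟩)

theorem isHalfIntegral_alternateRound (hx : IsHalfIntegral x) {C : Finset (Sym2 V)}
    (hC : C ∈ oddCycles x) {v : V} {c : G.Walk v v} (hc : Traverses c C) :
    IsHalfIntegral (alternateRound c x) := by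
  refine ⟨⟨fun e => ?_, fun t => ?_⟩, fun e => ?_⟩
  · by_cases he : (e : Sym2 V) ∈ C
    · rcases alternateRound_of_mem (x := x) hc he with h | h <;> rw [h]; norm_num
    · rw [alternateRound_of_notMem hc he]; exact hx.1.1 e
  · change load (alternateRound c x) t ≤ 1
    rw [load_alternateRound hx.1 hC hc]
    split_ifs
    · norm_num
    · exact hx.1.2 t
  · by_cases he : (e : Sym2 V) ∈ C
    · rcases alternateRound_of_mem (x := x) hc he with h | h
      · exact Or.inl h
      · exact Or.inr (Or.inl h)
    · rw [alternateRound_of_notMem hc he, oddCycles_alternateRound hx.1 hC hc]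
      refine (hx.2 e).imp_right (Or.imp_right ?_)
      rintro ⟨D, hD, heD⟩
      exact ⟨D, ⟨hD, fun h => he (h ▸ heD)⟩, heD⟩

/-- The first edge has value `0`, so `u` gains `1`; at `v` the sign depends on whether the last edge
is matched. -/
theorem load_complementOn {u v : V} {p : G.Walk u v} (hp : p.IsTrail) (huv : u ≠ v)
    (h : ZeroOneAlong x p) (t : V) :
    load (complementOn p x) t = load x t + (if t = u then 1 else 0) +
      (if t = v then 1 - 2 * extendZero x s(p.penultimate, v) else 0) := by
  have hn : ¬p.Nil := SimpleGraph.Walk.not_nil_of_ne huv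
  have hlen : 0 < p.edges.length := by
    rw [SimpleGraph.Walk.length_edges]
    exact SimpleGraph.Walk.not_nil_iff_lt_length.1 hn
  have hchain : p.edges.IsChain (fun e f => 1 - 2 * extendZero x f = -(1 - 2 * extendZero x e)) := by
    rw [List.isChain_iff_getElem]
    intro i hi
    rw [h i (by omega), h (i + 1) hi]
    by_cases h : Even i <;> simp [Nat.even_add_one, h] <;> norm_num
  have hadd : complementOn p x = x + fun e : G.edgeSet => if (e : Sym2 V) ∈ p.edges then
      (fun E => 1 - 2 * extendZero x E) (e : Sym2 V) else 0 := by
    ext e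
    simp only [complementOn, Pi.add_apply, extendZero_coe]
    split_ifs <;> ring
  have h0 := h 0 hlen
  rw [fst_edge_eq hlen] at h0
  rw [hadd, load_add, load_alternating hp hn hchain, h0]
  simp [add_assoc]

theorem isHalfIntegral_complementOn (hx : IsHalfIntegral x) {u v : V} {p : G.Walk u v}
    (hp : p.IsTrail) (huv : u ≠ v) (h : ZeroOneAlong x p) (hu : load x u = 0)
    (hv : extendZero x s(p.penultimate, v) = 1 ∨ load x v = 0) :
    IsHalfIntegral (complementOn p x) ∧
      (∀ t, t ≠ v → load (complementOn p x) t = if t = u then 1 else load x t) ∧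
      (load x v = 0 → load (complementOn p x) v = 1) := by
  have hlast : load x v = 0 → extendZero x s(p.penultimate, v) = 0 := by
    intro h0
    have hm : s(p.penultimate, v) ∈ p.edges :=
      SimpleGraph.Walk.mk_penultimate_end_mem_edges (SimpleGraph.Walk.not_nil_of_ne huv)
    rw [extendZero_apply x (p.edges_subset_edgeSet hm)]
    refine le_antisymm ?_ (hx.1.1 _)
    rw [← h0]
    exact mem_load_ge hx.1.1 (Sym2.mem_mk_right _ _)
  have hload : ∀ t, t ≠ v → load (complementOn p x) t = if t = u then 1 else load x t := by
    intro t ht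
    rw [load_complementOn hp huv h, if_neg ht, add_zero]
    split_ifs with htu
    · rw [htu, hu, zero_add]
    · rw [add_zero]
  have hloadv : load x v = 0 → load (complementOn p x) v = 1 := by
    intro h0
    rw [load_complementOn hp huv h, hlast h0, h0]
    simp [huv.symm]
  refine ⟨⟨⟨fun e => ?_, fun t => ?_⟩, fun e => ?_⟩, hload, hloadv⟩
  · simp only [complementOn]
    split_ifs
    · linarith [le_one_of_mem hx.1 e]
    · exact hx.1.1 e
  · change load (complementOn p x) t ≤ 1
    by_cases ht : t = v
    · subst ht
      rcases hv with hv | hv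
      · rw [load_complementOn hp huv h, hv]
        have : load x t ≤ 1 := hx.1.2 t
        simp only [huv.symm, if_false, if_true]
        linarith
      · exact (hloadv hv).le
    · rw [hload t ht]
      split_ifs
      · exact le_rfl
      · exact hx.1.2 t
  · rw [oddCycles_complementOn]
    by_cases he : (e : Sym2 V) ∈ p.edges
    · simp only [complementOn, he, if_true]
      rcases h.zero_or_one he with h | h <;> rw [h] <;> simp
    · simpa only [complementOn, he, if_false] using hx.2 e

/-- At `u` all nonzero edges have value `1/2`, so the first edge is unmatched and alternation fixes
the parity of the matched ones. An unmatched edge next to a matched one has value `0`. A path of a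
single edge has value `0` because otherwise that edge, and with it `v`, would lie on `C`. -/
theorem zeroOneAlong_of_alternating (hx : x ∈ fractionalMatchings G) {C : Finset (Sym2 V)}
    (hC : C ∈ oddCycles x) {u v : V} (hu : u ∈ cycleVertices C) (hv : v ∉ cycleVertices C)
    {p : G.Walk u v} (hp : Alternating (matchedEdges x) p) : ZeroOneAlong x p := by
  rw [Alternating, List.isChain_iff_getElem] at hp
  have hmem : ∀ i (hi : i < p.edges.length), p.edges[i] ∈ G.edgeSet :=
    fun i hi => p.edges_subset_edgeSet (List.getElem_mem hi)
  have hfirst : ∀ h : 0 < p.edges.length, extendZero x p.edges[0] ≠ 0 → p.edges[0] ∈ C := by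
    intro h h0
    rw [extendZero_apply x (hmem 0 h)] at h0
    exact mem_cycle_of_ne_zero hx hC hu (by simp [SimpleGraph.Walk.getElem_edges]) h0
  have hpar : ∀ i (hi : i < p.edges.length), p.edges[i] ∈ matchedEdges x ↔ ¬Even i := by
    intro i
    induction i with
    | zero =>
      intro hi
      simp only [Even.zero, not_true_eq_false, iff_false]
      intro hm
      have h1 := extendZero_eq_one_iff.2 hm
      have hmC := hfirst hi (by rw [h1]; norm_num)
      rw [extendZero_apply x (hmem 0 hi)] at h1
      have := hC.2.2 ⟨_, hmem 0 hi⟩ hmC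
      rw [h1] at this
      norm_num at this
    | succ k ih =>
      intro hi
      have := ih (by omega)
      have := hp k hi
      rw [Nat.even_add_one]
      tauto
  have hadj : ∀ i (hi : i + 1 < p.edges.length),
      extendZero x p.edges[i] + extendZero x p.edges[i + 1] ≤ 1 := by
    intro i hi
    have hne : p.edges[i] ≠ p.edges[i + 1] := by
      intro h
      have := hp i hi
      rw [h] at this
      tauto
    rw [extendZero_apply x (hmem i (by omega)), extendZero_apply x (hmem (i + 1) hi)]
    refine (add_le_load hx.1 (t := p.getVert (i + 1)) (fun h => hne (congrArg Subtype.val h))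
      ?_ ?_).trans (hx.2 _) <;> simp [SimpleGraph.Walk.getElem_edges]
  have hnn : ∀ i (hi : i < p.edges.length), 0 ≤ extendZero x p.edges[i] := by
    intro i hi
    rw [extendZero_apply x (hmem i hi)]
    exact hx.1 _
  intro i hi
  split_ifs with he
  · rcases Nat.eq_zero_or_pos i with rfl | hpos
    · by_contra hne
      by_cases h1 : 1 < p.edges.length
      · have := hadj 0 h1
        have h2 := extendZero_eq_one_iff.2 ((hpar 1 h1).2 (by decide))
        have := hnn 0 hi
        simp only [zero_add] at *
        exact hne (by linarith)
      · have hmC := hfirst hi hne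
        refine hv ⟨_, hmC, ?_⟩
        have hlast := last_edge_eq hi
        simp only [show p.edges.length - 1 = 0 by omega] at hlast
        rw [hlast]
        exact Sym2.mem_mk_right _ _
    · obtain ⟨k, rfl⟩ := Nat.exists_eq_add_of_le' hpos
      have := hadj k hi
      have h2 := extendZero_eq_one_iff.2 ((hpar k (by omega)).2 (by
        rwa [Nat.even_add_one] at he))
      have := hnn (k + 1) hi
      linarith
  · exact extendZero_eq_one_iff.2 ((hpar i hi).2 he)

theorem load_eq_zero_of_exposed (hx : IsHalfIntegral x) {v : V}
    (hv : ∀ D ∈ oddCycles x, v ∉ cycleVertices D) (he : Exposed (matchedEdges x) v) :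
    load x v = 0 := by
  refine Finset.sum_eq_zero fun e hve => ?_
  have hve : v ∈ (e : Sym2 V) := by simpa using hve
  rcases hx.2 e with h | h | ⟨D, hD, heD⟩
  · exact h
  · exact absurd hve (he e ⟨e.2, h⟩)
  · exact absurd ⟨e, heD, hve⟩ (hv D hD)

variable {w : G.edgeSet → ℝ} {y : V → ℝ}

theorem round_zeroOnCycle (hx : IsHalfIntegral x) (hy : y ∈ fractionalCovers G w)
    (hs : Slack w x y) {C : Finset (Sym2 V)} {v : V} (h : ZeroOnCycle x y C v) {c : G.Walk v v}
    (hc : Traverses c C) :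
    alternateRound c x ∈ basicMaxFractionalMatchings G w ∧
      oddCycles (alternateRound c x) ⊂ oddCycles x := by
  obtain ⟨hC, -, hyv⟩ := h
  refine ⟨mem_basic_of_slack (isHalfIntegral_alternateRound hx hC hc) hy
    ⟨tight_alternateRound hs.1 hC hc, fun t ht => ?_⟩, ?_⟩
  · rw [load_alternateRound hx.1 hC hc, if_neg (by rintro rfl; exact ht hyv), hs.2 t ht]
  · rw [oddCycles_alternateRound hx.1 hC hc]
    exact Set.sdiff_singleton_ssubset.2 hC

theorem round_cycleToCycle (hx : IsHalfIntegral x) (hy : y ∈ fractionalCovers G w)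
    (hs : Slack w x y) {C D : Finset (Sym2 V)} {u v : V} {p : G.Walk u v}
    (h : CycleToCycle w x y C D p) {c : G.Walk u u} {d : G.Walk v v} (hc : Traverses c C)
    (hd : Traverses d D) :
    complementOn p (alternateRound d (alternateRound c x)) ∈ basicMaxFractionalMatchings G w ∧
      oddCycles (complementOn p (alternateRound d (alternateRound c x))) ⊂ oddCycles x := by
  obtain ⟨hC, hD, hCD, hu, hv, hp, halt, htight⟩ := h
  have hvC : v ∉ cycleVertices C := fun h => hCD (cycle_eq hx.1 hC hD h hv)
  have huv : u ≠ v := fun h => hvC (h ▸ hu)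
  have h1 := isHalfIntegral_alternateRound hx hC hc
  have hD1 : D ∈ oddCycles (alternateRound c x) := by
    rw [oddCycles_alternateRound hx.1 hC hc]; exact ⟨hD, hCD.symm⟩
  have h2 := isHalfIntegral_alternateRound h1 hD1 hd
  -- Rounding alters only edges of value `1/2`, so the `0, 1, 0, …` pattern on the path survives it.
  have hz := ((zeroOneAlong_of_alternating hx.1 hC hu hvC halt).alternateRound hC hc).alternateRound
    hD1 hd
  have hl : ∀ t, load (alternateRound d (alternateRound c x)) t =
      if t = v then 0 else if t = u then 0 else load x t := fun t => by
    rw [load_alternateRound h1.1 hD1 hd, load_alternateRound hx.1 hC hc]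
  have hlv : load (alternateRound d (alternateRound c x)) v = 0 := by rw [hl, if_pos rfl]
  obtain ⟨h3, hl3, hl3v⟩ := isHalfIntegral_complementOn h2 hp.isTrail huv hz
    (by rw [hl, if_neg huv, if_pos rfl]) (Or.inr hlv)
  refine ⟨mem_basic_of_slack h3 hy ⟨tight_complementOn
    (tight_alternateRound (tight_alternateRound hs.1 hC hc) hD1 hd) htight, fun t ht => ?_⟩, ?_⟩
  · by_cases htv : t = v
    · rw [htv, hl3v hlv]
    · rw [hl3 t htv, hl, if_neg htv]
      split_ifs <;> [rfl; exact hs.2 t ht]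
  · rw [oddCycles_complementOn, oddCycles_alternateRound h1.1 hD1 hd,
      oddCycles_alternateRound hx.1 hC hc]
    exact Set.sdiff_subset.trans_ssubset (Set.sdiff_singleton_ssubset.2 hC)

theorem round_cycleToZero (hx : IsHalfIntegral x) (hy : y ∈ fractionalCovers G w)
    (hs : Slack w x y) {C : Finset (Sym2 V)} {u v : V} {p : G.Walk u v}
    (h : CycleToZero w x y C p) {c : G.Walk u u} (hc : Traverses c C) :
    complementOn p (alternateRound c x) ∈ basicMaxFractionalMatchings G w ∧
      oddCycles (complementOn p (alternateRound c x)) ⊂ oddCycles x := by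
  obtain ⟨hC, hu, hv, hyv, hp, halt, hval, htight⟩ := h
  have huv : u ≠ v := fun h => hv C hC (h ▸ hu)
  have h1 := isHalfIntegral_alternateRound hx hC hc
  have hz0 := zeroOneAlong_of_alternating hx.1 hC hu (hv C hC) halt
  have hz := hz0.alternateRound hC hc
  have hl := load_alternateRound hx.1 hC hc
  have hlast : extendZero (alternateRound c x) s(p.penultimate, v) = 1 ∨
      load (alternateRound c x) v = 0 := by
    rcases hval.2 with hexp | ⟨e, he, heM⟩
    · right
      rw [hl, if_neg huv.symm, load_eq_zero_of_exposed hx hv hexp]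
    · left
      have hlen : 0 < p.edges.length := by
        rw [SimpleGraph.Walk.length_edges]
        exact SimpleGraph.Walk.not_nil_iff_lt_length.1 (SimpleGraph.Walk.not_nil_of_ne huv)
      rw [List.getLast?_eq_getElem?, List.getElem?_eq_getElem (by omega), Option.mem_some] at he
      have hlt : p.edges.length - 1 < p.edges.length := by omega
      rw [← last_edge_eq hlen, hz _ hlt, ← hz0 _ hlt, he]
      exact extendZero_eq_one_iff.2 heM
  obtain ⟨h3, hl3, -⟩ := isHalfIntegral_complementOn h1 hp.isTrail huv hz
    (by rw [hl, if_pos rfl]) hlast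
  refine ⟨mem_basic_of_slack h3 hy ⟨tight_complementOn
    (tight_alternateRound hs.1 hC hc) htight, fun t ht => ?_⟩, ?_⟩
  · rw [hl3 t (by rintro rfl; exact ht hyv), hl]
    split_ifs <;> [rfl; exact hs.2 t ht]
  · rw [oddCycles_complementOn, oddCycles_alternateRound hx.1 hC hc]
    exact Set.sdiff_singleton_ssubset.2 hC

end Operations

/-! ### Alternating orbits of two involutions. -/

section Zigzag

variable {V : Type*} {σ τ : V → V} {a b : V}

/-- The sequence `a, τ a, σ (τ a), τ (σ (τ a)), …`. -/
def zigzag (σ τ : V → V) (a : V) : ℕ → V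
  | 0 => a
  | n + 1 => if Even n then τ (zigzag σ τ a n) else σ (zigzag σ τ a n)

theorem zigzag_succ_of_even {n : ℕ} (h : Even n) :
    zigzag σ τ a (n + 1) = τ (zigzag σ τ a n) := by simp [zigzag, h]

theorem zigzag_succ_of_odd {n : ℕ} (h : ¬Even n) :
    zigzag σ τ a (n + 1) = σ (zigzag σ τ a n) := by simp [zigzag, h]

theorem zigzag_back (hσ : σ.Involutive) (hτ : τ.Involutive) {m n : ℕ}
    (hmn : Even m ↔ Even n) (h : zigzag σ τ a (m + 1) = zigzag σ τ b (n + 1)) :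
    zigzag σ τ a m = zigzag σ τ b n := by
  by_cases hm : Even m
  · rw [zigzag_succ_of_even hm, zigzag_succ_of_even (hmn.1 hm)] at h
    exact hτ.injective h
  · rw [zigzag_succ_of_odd hm, zigzag_succ_of_odd (fun h => hm (hmn.2 h))] at h
    exact hσ.injective h

/-- The zigzag sequence first stays put in step `L`. -/
def StopsAt (σ τ : V → V) (a : V) (L : ℕ) : Prop :=
  zigzag σ τ a (L + 1) = zigzag σ τ a L ∧ ∀ k < L, zigzag σ τ a (k + 1) ≠ zigzag σ τ a k

/-- The step into an even position applies `σ`, which fixes `a`; so arriving at `a` means having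
been there already. -/
theorem zigzag_ne_start (hσ : σ.Involutive) (ha : σ a = a) {L : ℕ}
    (h : ∀ k < L, zigzag σ τ b (k + 1) ≠ zigzag σ τ b k) {j : ℕ} (hj : 0 < j) (hjL : j ≤ L)
    (he : Even j) : zigzag σ τ b j ≠ a := by
  obtain ⟨k, rfl⟩ := Nat.exists_eq_add_of_le' (show 1 ≤ j from hj)
  intro hk
  refine h k (by omega) ?_
  rw [hk, ← hσ (zigzag σ τ b k), ← zigzag_succ_of_odd (σ := σ) (τ := τ)
    (fun h => by rw [Nat.even_add_one] at he; exact he h), hk, ha]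

/-- For indices of equal parity, step back from both until the smaller is `0`. For opposite parity,
the same involution leaves `i` and enters `j`, so the coincidence moves inward until two consecutive
terms agree. -/
theorem zigzag_ne (hσ : σ.Involutive) (hτ : τ.Involutive) (ha : σ a = a) {L : ℕ}
    (h : ∀ k < L, zigzag σ τ a (k + 1) ≠ zigzag σ τ a k) {i j : ℕ} (hij : i < j) (hj : j ≤ L) :
    zigzag σ τ a i ≠ zigzag σ τ a j := by
  by_cases hpar : Even i ↔ Even j
  · induction i generalizing j with
    | zero => exact fun h' => zigzag_ne_start hσ ha h hij hj (hpar.1 Even.zero) h'.symm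
    | succ i ih =>
      obtain ⟨j, rfl⟩ := Nat.exists_eq_add_of_le' (show 1 ≤ j by omega)
      have hp : Even i ↔ Even j := by
        rw [Nat.even_add_one, Nat.even_add_one] at hpar; tauto
      exact fun h' => ih (by omega) (by omega) hp (zigzag_back hσ hτ hp h')
  · obtain ⟨d, rfl⟩ := Nat.exists_eq_add_of_lt hij
    induction d using Nat.strong_induction_on generalizing i with
    | _ d ih =>
      intro h'
      have hd : Even d := by
        by_contra hd
        refine hpar ?_
        rw [Nat.even_add_one, Nat.even_add]; tauto
      rcases Nat.lt_or_ge d 2 with h2 | h2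
      · have : d = 0 := by
          rcases hd with ⟨r, rfl⟩
          omega
        subst this
        exact h i (by omega) h'.symm
      · obtain ⟨d, rfl⟩ := Nat.exists_eq_add_of_le' h2
        have hp : Even i ↔ Even (i + (d + 2)) := by
          rw [Nat.even_add]; tauto
        refine ih d (by omega) (i := i + 1) (by omega) (by omega) ?_ ?_
        · intro h0
          refine hpar ?_
          rw [Nat.even_add_one] at h0
          grind
        · rw [show i + 1 + d + 1 = i + (d + 2) by ring]
          by_cases he : Even i
          · rw [zigzag_succ_of_even (hp.1 he)] at h'
            rw [zigzag_succ_of_even he, h', hτ]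
          · rw [zigzag_succ_of_odd (fun h => he (hp.2 h))] at h'
            rw [zigzag_succ_of_odd he, h', hσ]

theorem exists_stopsAt [Finite V] (hσ : σ.Involutive) (hτ : τ.Involutive) (ha : σ a = a) :
    ∃ L, StopsAt σ τ a L := by
  classical
  have hex : ∃ L, zigzag σ τ a (L + 1) = zigzag σ τ a L := by
    by_contra! hcon
    refine not_injective_infinite_finite (zigzag σ τ a) fun i j hij => ?_
    rcases lt_trichotomy i j with h | h | h
    · exact absurd hij (zigzag_ne hσ hτ ha (L := j) (fun k _ => hcon k) h le_rfl)
    · exact h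
    · exact absurd hij.symm (zigzag_ne hσ hτ ha (L := i) (fun k _ => hcon k) h le_rfl)
  exact ⟨Nat.find hex, Nat.find_spec hex, fun k hk => Nat.find_min hex hk⟩

/-- The even lengths let both sequences be run backwards in parallel; if one is longer, it meets the
start of the other at a positive even index. -/
theorem start_eq_of_end_eq (hσ : σ.Involutive) (hτ : τ.Involutive) (ha : σ a = a) {L M : ℕ}
    (hM : StopsAt σ τ b M) (hLe : Even L) (hMe : Even M) (hLM : L ≤ M)
    (h : zigzag σ τ a L = zigzag σ τ b M) : a = b := by
  have hback : ∀ k ≤ L, zigzag σ τ a (L - k) = zigzag σ τ b (M - k) := by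
    intro k
    induction k with
    | zero => simpa using h
    | succ k ih =>
      intro hk
      have := ih (by omega)
      rw [show L - k = L - (k + 1) + 1 by omega, show M - k = M - (k + 1) + 1 by omega] at this
      exact zigzag_back hσ hτ (by grind) this
  have h0 := hback L le_rfl
  rw [Nat.sub_self] at h0
  rcases Nat.eq_zero_or_pos (M - L) with h1 | h1
  · rw [h1] at h0; exact h0
  · exact absurd h0.symm (zigzag_ne_start hσ ha hM.2 h1 (by omega) (by grind))

/-- Otherwise sending each start to its end would inject `A` into `B`. -/
theorem exists_zigzag_end [Finite V] (hσ : σ.Involutive) (hτ : τ.Involutive) {A B : Finset V}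
    (hA : ∀ a ∈ A, σ a = a) (hcard : B.card < A.card) :
    ∃ a ∈ A, ∃ L, StopsAt σ τ a L ∧ ¬(Even L ∧ zigzag σ τ a L ∈ B) := by
  by_contra! hcon
  have : ∀ a : A, ∃ L, StopsAt σ τ a L ∧ Even L ∧ zigzag σ τ a L ∈ B := by
    rintro ⟨a, ha⟩
    obtain ⟨L, hL⟩ := exists_stopsAt hσ hτ (hA a ha)
    exact ⟨L, hL, hcon a ha L hL⟩
  choose L hL using this
  have hle : Fintype.card A ≤ Fintype.card B := by
    refine Fintype.card_le_of_injective (fun a => (⟨zigzag σ τ a (L a), (hL a).2.2⟩ : B)) ?_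
    intro a b hab
    have hab' : zigzag σ τ a (L a) = zigzag σ τ b (L b) := congrArg Subtype.val hab
    rcases le_total (L a) (L b) with h | h
    · exact Subtype.ext (start_eq_of_end_eq hσ hτ (hA a a.2) (hL b).1 (hL a).2.1 (hL b).2.1 h hab')
    · exact Subtype.ext (start_eq_of_end_eq hσ hτ (hA b b.2) (hL a).1 (hL b).2.1 (hL a).2.1 h
        hab'.symm).symm
  simp only [Fintype.card_coe] at hle
  omega

theorem exists_last_before {P : ℕ → Prop} (h0 : P 0) {j : ℕ} (hj : 0 < j) :
    ∃ i < j, P i ∧ ∀ k, i < k → k < j → ¬P k := by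
  induction j with
  | zero => omega
  | succ j ih =>
    by_cases hP : P j
    · exact ⟨j, by omega, hP, fun k _ _ => by omega⟩
    · have : 0 < j := Nat.pos_of_ne_zero fun h => hP (h ▸ h0)
      obtain ⟨i, hi, hPi, hk⟩ := ih this
      refine ⟨i, by omega, hPi, fun k h1 h2 => ?_⟩
      rcases Nat.lt_succ_iff_lt_or_eq.1 h2 with h | rfl
      · exact hk k h1 h
      · exact hP

theorem exists_walk_of_seq {G : SimpleGraph V} (s : ℕ → V) (n i : ℕ)
    (h : ∀ k, i ≤ k → k < i + n → G.Adj (s k) (s (k + 1))) {v : V} (hv : s (i + n) = v) :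
    ∃ p : G.Walk (s i) v, p.length = n ∧ ∀ k ≤ n, p.getVert k = s (i + k) := by
  induction n generalizing i with
  | zero =>
    subst hv
    exact ⟨SimpleGraph.Walk.nil, rfl, fun k hk => by simp [Nat.le_zero.1 hk]⟩
  | succ n ih =>
    obtain ⟨q, hq, hqv⟩ := ih (i + 1) (fun k h1 h2 => h k (by omega) (by omega))
      (by rw [← hv]; congr 1; omega)
    refine ⟨.cons (h i le_rfl (by omega)) q, by simp [hq], fun k hk => ?_⟩
    cases k with
    | zero => simp
    | succ k =>
      rw [SimpleGraph.Walk.getVert_cons_succ, hqv k (by omega)]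
      congr 1
      omega

end Zigzag

/-! ### Rounding to integral matchings, and their partner involutions. -/

section Rounding

variable {V : Type*} [Fintype V] [DecidableEq V] {G : SimpleGraph V} [DecidableRel G.Adj]
  {x : G.edgeSet → ℝ}

/-- The odd cycles of a half-integral fractional matching can be rounded simultaneously, which
exposes exactly one vertex of each of them. -/
theorem exists_rounding (hx : IsHalfIntegral x) :
    ∃ z : G.edgeSet → ℝ, z ∈ fractionalMatchings G ∧ (∀ e, z e = 0 ∨ z e = 1) ∧
      (∀ e, x e = 1 → z e = 1) ∧
      (∀ e, z e = 1 → x e = 1 ∨ ∃ C ∈ oddCycles x, (e : Sym2 V) ∈ C) ∧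
      (∀ v, (∀ C ∈ oddCycles x, v ∉ cycleVertices C) → load z v = load x v) ∧
      ∀ C ∈ oddCycles x, ∃ v ∈ cycleVertices C, ∀ u ∈ cycleVertices C, load z u = 0 ↔ u = v := by
  induction hn : (oddCycles x).ncard generalizing x with
  | zero =>
    have h0 : oddCycles x = ∅ := (Set.ncard_eq_zero (Set.toFinite _)).1 hn
    refine ⟨x, hx.1, fun e => ?_, fun e h => h, fun e h => Or.inl h, fun v _ => rfl,
      by simp [h0]⟩
    simpa [h0] using hx.2 e
  | succ n ih =>
    obtain ⟨C, hC⟩ : (oddCycles x).Nonempty := by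
      rw [← Set.ncard_pos (Set.toFinite _)]; omega
    obtain ⟨⟨v, c, hc⟩, -⟩ := id hC
    have h1 := isHalfIntegral_alternateRound hx hC hc
    have hO := oddCycles_alternateRound hx.1 hC hc
    have hl := load_alternateRound hx.1 hC hc
    obtain ⟨z, hz, hz01, hz1, hz1', hzl, hzC⟩ := ih h1 (by
      rw [hO, Set.ncard_sdiff_singleton_of_mem hC, hn]; rfl)
    have hxC : ∀ e : G.edgeSet, (e : Sym2 V) ∉ C → alternateRound c x e = x e :=
      fun e he => alternateRound_of_notMem hc he
    refine ⟨z, hz, hz01, fun e he => hz1 e ?_, fun e he => ?_, fun u hu => ?_, fun D hD => ?_⟩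
    · rw [hxC e, he]
      intro heC
      have := hC.2.2 e heC
      rw [he] at this
      norm_num at this
    · by_cases heC : (e : Sym2 V) ∈ C
      · exact Or.inr ⟨C, hC, heC⟩
      · rcases hz1' e he with h | ⟨D, hD, heD⟩
        · left; rwa [hxC e heC] at h
        · rw [hO] at hD
          exact Or.inr ⟨D, hD.1, heD⟩
    · rw [hzl u (fun D hD => hu D (by rw [hO] at hD; exact hD.1)), hl, if_neg]
      rintro rfl
      exact hu C hC hc.mem_cycleVertices
    · by_cases hDC : D = C
      · subst hDC
        refine ⟨v, hc.mem_cycleVertices, fun u hu => ?_⟩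
        rw [hzl u (fun E hE huE => ?_), hl]
        · split_ifs with h
          · simp [h]
          · simp [h, load_eq_one_of_cycle hx.1 hD hu]
        · rw [hO] at hE
          exact hE.2 (cycle_eq hx.1 hE.1 hD huE hu)
      · exact hzC D (by rw [hO]; exact ⟨hD, hDC⟩)

/-- The involution that exchanges the ends of the edges of an integral matching. -/
theorem exists_partner {z : G.edgeSet → ℝ} (hz : z ∈ fractionalMatchings G)
    (h01 : ∀ e, z e = 0 ∨ z e = 1) :
    ∃ σ : V → V, σ.Involutive ∧ (∀ v, σ v = v ↔ load z v = 0) ∧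
      ∀ u v, u ≠ v → (σ u = v ↔ ∃ h : G.Adj u v, z ⟨s(u, v), h⟩ = 1) := by
  classical
  have huniq : ∀ u v v' (h : G.Adj u v) (h' : G.Adj u v'), z ⟨s(u, v), h⟩ = 1 →
      z ⟨s(u, v'), h'⟩ = 1 → v = v' := by
    intro u v v' h h' h1 h1'
    by_contra hne
    have := add_le_load hz.1 (t := u) (e := ⟨s(u, v), h⟩) (f := ⟨s(u, v'), h'⟩)
      (fun hE => hne (Sym2.congr_right.1 (congrArg Subtype.val hE))) (Sym2.mem_mk_left _ _)
      (Sym2.mem_mk_left _ _)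
    have hu : load z u ≤ 1 := hz.2 u
    linarith
  -- Exposed vertices are their own partners.
  have hex : ∀ u, ∃ v, (∃ h : G.Adj u v, z ⟨s(u, v), h⟩ = 1) ∨
      (v = u ∧ ∀ v', ∀ h : G.Adj u v', z ⟨s(u, v'), h⟩ ≠ 1) := by
    intro u
    by_cases h : ∃ v, ∃ h : G.Adj u v, z ⟨s(u, v), h⟩ = 1
    · exact h.imp fun _ => Or.inl
    · push Not at h
      exact ⟨u, Or.inr ⟨rfl, h⟩⟩
  choose σ hσ using hex
  have hiff : ∀ u v, u ≠ v → (σ u = v ↔ ∃ h : G.Adj u v, z ⟨s(u, v), h⟩ = 1) := by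
    intro u v huv
    constructor
    · rintro rfl
      exact (hσ u).resolve_right fun h => huv h.1.symm
    · rintro ⟨h, h1⟩
      rcases hσ u with ⟨h', h1'⟩ | ⟨-, hno⟩
      · exact huniq u _ _ h' h h1' h1
      · exact absurd h1 (hno v h)
  refine ⟨σ, fun u => ?_, fun u => ?_, hiff⟩
  · by_cases hu : σ u = u
    · rw [hu, hu]
    · obtain ⟨h, h1⟩ := (hiff u (σ u) (Ne.symm hu)).1 rfl
      refine (hiff (σ u) u hu).2 ⟨h.symm, ?_⟩
      rw [← h1]
      congr 2
      exact Sym2.eq_swap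
  · constructor
    · intro hu
      refine Finset.sum_eq_zero fun e hue => (h01 e).resolve_right fun h1 => ?_
      obtain ⟨e, he⟩ := e
      obtain ⟨v, rfl⟩ : u ∈ e := by simpa using hue
      have := (hiff u v (G.ne_of_adj he)).2 ⟨he, h1⟩
      exact G.ne_of_adj he (hu.symm.trans this)
    · intro hl
      by_contra hu
      obtain ⟨h, h1⟩ := (hiff u (σ u) (Ne.symm hu)).1 rfl
      have := mem_load_ge hz.1 (t := u) (e := ⟨s(u, σ u), h⟩) (Sym2.mem_mk_left _ _)
      linarith

end Rounding

/-! ### Existence of one of the three structures. -/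

section Existence

variable {V : Type*} {G : SimpleGraph V} {w x : G.edgeSet → ℝ} {y : V → ℝ}

theorem exists_alternating_path {s : ℕ → V} {i j : ℕ} (hij : i < j) (hi : Even i)
    (hinj : ∀ k l, i ≤ k → k < l → l ≤ j → s k ≠ s l)
    (hstep : ∀ k, i ≤ k → k < j → ∃ h : G.Adj (s k) (s (k + 1)),
      y (s k) + y (s (k + 1)) = w ⟨s(s k, s (k + 1)), h⟩ ∧
      (x ⟨s(s k, s (k + 1)), h⟩ = 1 ↔ ¬Even k)) :
    ∃ p : G.Walk (s i) (s j), p.IsPath ∧ Alternating (matchedEdges x) p ∧ Tight w y p ∧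
      (Even j → ∃ e ∈ p.edges.getLast?, e ∈ matchedEdges x) := by
  obtain ⟨n, rfl⟩ := Nat.exists_eq_add_of_le hij.le
  obtain ⟨p, hp, hv⟩ := exists_walk_of_seq s n i
    (fun k h1 h2 => (hstep k h1 h2).1) (v := s (i + n)) rfl
  have hedge : ∀ k (hk : k < p.edges.length), p.edges[k] = s(s (i + k), s (i + k + 1)) := by
    intro k hk
    rw [SimpleGraph.Walk.length_edges] at hk
    rw [SimpleGraph.Walk.getElem_edges, hv k (by omega), hv (k + 1) (by omega), add_assoc]
  have hM : ∀ k (hk : k < p.edges.length), p.edges[k] ∈ matchedEdges x ↔ ¬Even k := by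
    intro k hk
    have hk' := hk
    rw [SimpleGraph.Walk.length_edges, hp] at hk'
    obtain ⟨h, -, h1⟩ := hstep (i + k) (by omega) (by omega)
    rw [hedge k hk, ← extendZero_eq_one_iff, extendZero_apply x h, h1, Nat.even_add]
    tauto
  refine ⟨p, ?_, ?_, ?_, fun hj => ?_⟩
  · rw [← SimpleGraph.Walk.IsPath.getVert_injOn_iff]
    intro k hk l hl hkl
    simp only [Set.mem_ofPred_eq, hp] at hk hl
    rw [hv k hk, hv l hl] at hkl
    rcases lt_trichotomy k l with h | h | h
    · exact absurd hkl (hinj _ _ (by omega) (by omega) (by omega))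
    · exact h
    · exact absurd hkl.symm (hinj _ _ (by omega) (by omega) (by omega))
  · rw [Alternating, List.isChain_iff_getElem]
    intro k hk
    rw [hM, hM, Nat.even_add_one]
    tauto
  · intro a b h hab
    obtain ⟨k, hk, hE⟩ := List.mem_iff_getElem.1 hab
    rw [hedge k hk] at hE
    rw [SimpleGraph.Walk.length_edges, hp] at hk
    obtain ⟨h', ht, -⟩ := hstep (i + k) (by omega) (by omega)
    have hw : w ⟨s(a, b), h⟩ = w ⟨s(s (i + k), s (i + k + 1)), h'⟩ := by congr 2; exact hE.symm
    rw [hw, ← ht]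
    rcases Sym2.eq_iff.1 hE with ⟨h1, h2⟩ | ⟨h1, h2⟩
    · rw [h1, h2]
    · rw [h1, h2, add_comm]
  · have hlen : p.edges.length = n := by rw [SimpleGraph.Walk.length_edges, hp]
    have hlt : n - 1 < p.edges.length := by omega
    refine ⟨p.edges[n - 1], ?_, (hM _ hlt).2 (by grind)⟩
    rw [List.getLast?_eq_getElem?, hlen, List.getElem?_eq_getElem hlt]
    rfl

variable [Fintype V] [DecidableEq V] [DecidableRel G.Adj]

theorem exists_mem_cycle_of_exposed (hs : Slack w x y)
    {z : G.edgeSet → ℝ}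
    (hl : ∀ v, (∀ C ∈ oddCycles x, v ∉ cycleVertices C) → load z v = load x v)
    {v : V} (hz : load z v = 0) (hy : y v ≠ 0) : ∃ C ∈ oddCycles x, v ∈ cycleVertices C := by
  by_contra! h
  have := hs.2 v hy
  rw [← hl v h, hz] at this
  norm_num at this

/-- If a zigzag sequence of integral matchings, obtained by rounding two optimal half-integral
fractional matchings, does not end in a vertex exposed by the second one with positive dual value,
then it contains one of the two kinds of paths. -/
theorem exists_path_of_zigzag {x' z z' : G.edgeSet → ℝ} {σ τ : V → V}
    (hx : x ∈ fractionalMatchings G)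
    (hs : Slack w x y) (hs' : Slack w x' y)
    (hzero : ∀ C v, ¬ZeroOnCycle x y C v)
    (hxz : ∀ e, x e = 1 → z e = 1)
    (hzx : ∀ e, z e = 1 → x e = 1 ∨ ∃ C ∈ oddCycles x, (e : Sym2 V) ∈ C)
    (hl : ∀ v, (∀ C ∈ oddCycles x, v ∉ cycleVertices C) → load z v = load x v)
    (hroot : ∀ C ∈ oddCycles x, ∃ v ∈ cycleVertices C, ∀ u ∈ cycleVertices C,
      load z u = 0 ↔ u = v)
    (hzx' : ∀ e, z' e = 1 → x' e = 1 ∨ ∃ C ∈ oddCycles x', (e : Sym2 V) ∈ C)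
    (hσ : σ.Involutive) (hσ0 : ∀ v, σ v = v ↔ load z v = 0)
    (hσ1 : ∀ u v, u ≠ v → (σ u = v ↔ ∃ h : G.Adj u v, z ⟨s(u, v), h⟩ = 1))
    (hτ : τ.Involutive) (hτ0 : ∀ v, τ v = v ↔ load z' v = 0)
    (hτ1 : ∀ u v, u ≠ v → (τ u = v ↔ ∃ h : G.Adj u v, z' ⟨s(u, v), h⟩ = 1))
    {a : V} (ha : load z a = 0) (hya : y a ≠ 0) {L : ℕ} (hL : StopsAt σ τ a L)
    (hend : ¬(Even L ∧ load z' (zigzag σ τ a L) = 0 ∧ y (zigzag σ τ a L) ≠ 0)) :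
    (∃ (C D : Finset (Sym2 V)) (u v : V) (P : G.Walk u v), CycleToCycle w x y C D P) ∨
      (∃ (C : Finset (Sym2 V)) (u v : V) (P : G.Walk u v), CycleToZero w x y C P) := by
  have haσ : σ a = a := (hσ0 a).2 ha
  have hinj : ∀ i j, i < j → j ≤ L → zigzag σ τ a i ≠ zigzag σ τ a j :=
    fun i j hij hj => zigzag_ne hσ hτ haσ hL.2 hij hj
  obtain ⟨C, hC, haC⟩ := exists_mem_cycle_of_exposed hs hl ha hya
  have hstart : zigzag σ τ a 0 = a := rfl
  have hLe := zigzag_succ_of_even (σ := σ) (τ := τ) (a := a) (n := L)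
  have hLo := zigzag_succ_of_odd (σ := σ) (τ := τ) (a := a) (n := L)
  rw [hL.1] at hLe hLo
  have heven : ∀ k < L, Even k → ∃ h : G.Adj (zigzag σ τ a k) (zigzag σ τ a (k + 1)),
      z' ⟨s(zigzag σ τ a k, zigzag σ τ a (k + 1)), h⟩ = 1 := fun k hk he =>
    (hτ1 _ _ (hL.2 k hk).symm).1 (zigzag_succ_of_even he).symm
  have hodd : ∀ k < L, ¬Even k → ∃ h : G.Adj (zigzag σ τ a k) (zigzag σ τ a (k + 1)),
      z ⟨s(zigzag σ τ a k, zigzag σ τ a (k + 1)), h⟩ = 1 := fun k hk he =>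
    (hσ1 _ _ (hL.2 k hk).symm).1 (zigzag_succ_of_odd he).symm
  -- Such an edge would also be in the matching of `σ`, so `σ` would lead forward from `s k`; but
  -- `σ` fixes the start and otherwise leads back to the previous vertex.
  have hnotM : ∀ k < L, Even k → ∀ h : G.Adj (zigzag σ τ a k) (zigzag σ τ a (k + 1)),
      x ⟨s(zigzag σ τ a k, zigzag σ τ a (k + 1)), h⟩ ≠ 1 := by
    intro k hk he h h1
    have hσk := (hσ1 _ _ (hL.2 k hk).symm).2 ⟨h, hxz _ h1⟩
    cases k with
    | zero => exact hL.2 0 hk (by rw [← hσk, hstart, haσ])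
    | succ k =>
      have hk' : ¬Even k := fun h => by rw [Nat.even_add_one] at he; exact he h
      rw [zigzag_succ_of_odd hk', hσ] at hσk
      exact hinj k (k + 2) (by omega) (by omega) hσk
  generalize zigzag σ τ a = s at *
  have hoddx : ∀ k < L, ¬Even k → ∃ h : G.Adj (s k) (s (k + 1)),
      x ⟨s(s k, s (k + 1)), h⟩ = 1 ∨ ∃ D ∈ oddCycles x, s(s k, s (k + 1)) ∈ D := fun k hk he => by
    obtain ⟨h, h1⟩ := hodd k hk he
    exact ⟨h, hzx _ h1⟩
  have hne0 : ∀ k < L, ¬Even k → ∃ h : G.Adj (s k) (s (k + 1)), x ⟨s(s k, s (k + 1)), h⟩ ≠ 0 := by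
    intro k hk he
    obtain ⟨h, h1 | ⟨D, hD, hE⟩⟩ := hoddx k hk he
    · exact ⟨h, by rw [h1]; norm_num⟩
    · exact ⟨h, by rw [hD.2.2 ⟨_, h⟩ hE]; norm_num⟩
  -- Odd steps use edges in the support of `x`, and these do not leave a cycle. Hence a cycle can
  -- only be left at an even position.
  have hstay : ∀ k < L, ¬Even k → ∀ D ∈ oddCycles x, s k ∈ cycleVertices D →
      s (k + 1) ∈ cycleVertices D := by
    intro k hk he D hD hkD
    obtain ⟨h, h0⟩ := hne0 k hk he
    exact ⟨_, mem_cycle_of_ne_zero hx hD hkD (Sym2.mem_mk_left _ _) h0, Sym2.mem_mk_right _ _⟩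
  -- Even steps lie in the support of `x'`, odd ones in that of `x`; the same `y` is slack with
  -- both.
  have htight : ∀ k < L, ∀ h : G.Adj (s k) (s (k + 1)),
      y (s k) + y (s (k + 1)) = w ⟨s(s k, s (k + 1)), h⟩ := by
    intro k hk h
    by_cases he : Even k
    · obtain ⟨h, h1⟩ := heven k hk he
      refine hs'.1 _ _ h ?_
      rcases hzx' _ h1 with h' | ⟨D, hD, hE⟩
      · rw [h']; norm_num
      · rw [hD.2.2 ⟨_, h⟩ hE]; norm_num
    · obtain ⟨h, h0⟩ := hne0 k hk he
      exact hs.1 _ _ h h0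
  have hpath : ∀ i j, i < j → j ≤ L → Even i →
      (∀ k, i < k → k < j → ¬∃ D ∈ oddCycles x, s k ∈ cycleVertices D) →
      ∃ p : G.Walk (s i) (s j), p.IsPath ∧ Alternating (matchedEdges x) p ∧ Tight w y p ∧
      (Even j → ∃ e ∈ p.edges.getLast?, e ∈ matchedEdges x) := by
    intro i j hij hj hi hint
    refine exists_alternating_path hij hi (fun k l _ hkl hl => hinj k l hkl (by omega))
      fun k hik hkj => ?_
    by_cases he : Even k
    · obtain ⟨h, -⟩ := heven k (by omega) he
      exact ⟨h, htight k (by omega) h, by simpa [he] using hnotM k (by omega) he h⟩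
    · obtain ⟨h, h1⟩ := hoddx k (by omega) he
      refine ⟨h, htight k (by omega) h, iff_of_true (h1.resolve_right ?_) he⟩
      rintro ⟨D, hD, hE⟩
      have hne : i ≠ k := fun h => he (h ▸ hi)
      exact hint k (by omega) hkj ⟨D, hD, _, hE, Sym2.mem_mk_left _ _⟩
  have hs0 : s 0 ∈ cycleVertices C := hstart ▸ haC
  -- Either the walk meets a second cycle of `x`, and its first such vertex ends the path, or the
  -- only cycle it ever touches is `C`.
  by_cases hexit : ∃ j ≤ L, (∃ D ∈ oddCycles x, s j ∈ cycleVertices D) ∧ s j ∉ cycleVertices C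
  · left
    classical
    obtain ⟨hjL, ⟨D, hD, hjD⟩, hjC⟩ := Nat.find_spec hexit
    have hmin := fun k (hk : k < Nat.find hexit) => Nat.find_min hexit hk
    generalize Nat.find hexit = j at *
    have hj0 : 0 < j := Nat.pos_of_ne_zero fun h => hjC (h ▸ hs0)
    obtain ⟨i, hij, hiW, hint⟩ := exists_last_before
      (P := fun k => ∃ D ∈ oddCycles x, s k ∈ cycleVertices D) ⟨C, hC, hs0⟩ hj0
    have hiC : s i ∈ cycleVertices C := by
      by_contra h
      exact hmin i hij ⟨by omega, hiW, h⟩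
    have hie : Even i := by
      by_contra he
      have h1 := hstay i (by omega) he C hC hiC
      rcases Nat.lt_or_ge (i + 1) j with h | h
      · exact hint (i + 1) (by omega) h ⟨C, hC, h1⟩
      · exact hjC (by rwa [show i + 1 = j by omega] at h1)
    obtain ⟨p, hp, halt, ht, -⟩ := hpath i j hij hjL hie hint
    exact ⟨C, D, _, _, p, hC, hD, fun h => hjC (h ▸ hjD), hiC, hjD, hp, halt, ht⟩
  · right
    push Not at hexit
    -- The bound `L + 1` lets the end `L` itself count as a candidate; `hlt` then rules it out.
    obtain ⟨i, hiL, hiW, hint⟩ := exists_last_before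
      (P := fun k => ∃ D ∈ oddCycles x, s k ∈ cycleVertices D) ⟨C, hC, hs0⟩ (Nat.succ_pos L)
    have hiC : s i ∈ cycleVertices C := hexit i (by omega) hiW
    have hyL : Even L → y (s L) = 0 := by
      intro he
      by_contra hy
      exact hend ⟨he, (hτ0 _).1 (hLe he).symm, hy⟩
    have hzL : ¬Even L → load z (s L) = 0 := fun he => (hσ0 _).1 (hLo he).symm
    have hlt : i < L := by
      refine lt_of_le_of_ne (by omega) ?_
      rintro rfl
      by_cases he : Even i
      · exact hzero C (s i) ⟨hC, hiC, hyL he⟩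
      -- An odd end is exposed by `z`. On `C` the only such vertex is `a`, which the walk does not
      -- revisit.
      · obtain ⟨r, -, hr⟩ := hroot C hC
        have h1 := (hr _ hiC).1 (hzL he)
        have h2 := (hr _ haC).1 ha
        have : 0 < i := Nat.pos_of_ne_zero fun h => he (h ▸ Even.zero)
        exact hinj 0 i this le_rfl (by rw [hstart, h1, h2])
    have hie : Even i := by
      by_contra he
      exact hint (i + 1) (by omega) (by omega) ⟨C, hC, hstay i hlt he C hC hiC⟩
    have hLW : ∀ D ∈ oddCycles x, s L ∉ cycleVertices D := fun D hD h =>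
      hint L hlt (by omega) ⟨D, hD, h⟩
    -- Off the cycles rounding preserves loads, so an odd end is exposed by `x` as well and
    -- slackness makes its dual value zero.
    have hxL : ¬Even L → load x (s L) = 0 := fun he => by rw [← hl _ hLW, hzL he]
    have hy0 : y (s L) = 0 := by
      by_cases he : Even L
      · exact hyL he
      · by_contra hy
        have := hs.2 _ hy
        rw [hxL he] at this
        norm_num at this
    obtain ⟨p, hp, halt, ht, hlast⟩ := hpath i L hlt le_rfl hie
      (fun k h1 h2 => hint k h1 (by omega))
    refine ⟨C, _, _, p, hC, hiC, hLW, hy0, hp, halt, ⟨Or.inl ?_, ?_⟩, ht⟩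
    · rintro e ⟨he, h1⟩ hie
      have h2 := hC.2.2 ⟨e, he⟩ (mem_cycle_of_ne_zero hx hC hiC (g := ⟨e, he⟩) hie (by
        rw [h1]; norm_num))
      rw [h1] at h2
      norm_num at h2
    · by_cases he : Even L
      · exact Or.inr (hlast he)
      · left
        rintro e ⟨heG, h1⟩ hLe
        have := mem_load_ge hx.1 (e := ⟨e, heG⟩) hLe
        rw [hxL he, h1] at this
        norm_num at this

theorem exists_structure (hx : x ∈ basicMaxFractionalMatchings G w)
    (hy : y ∈ minFractionalCovers G w) (hγ : gamma G w < (oddCycles x).ncard) :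
    (∃ C v, ZeroOnCycle x y C v) ∨
      (∃ (C D : Finset (Sym2 V)) (u v : V) (P : G.Walk u v), CycleToCycle w x y C D P) ∨
      (∃ (C : Finset (Sym2 V)) (u v : V) (P : G.Walk u v), CycleToZero w x y C P) := by
  by_cases hzero : ∃ C v, ZeroOnCycle x y C v
  · exact Or.inl hzero
  right
  push Not at hzero
  obtain ⟨x', hx', hx'γ⟩ := Nat.sInf_mem
    (⟨_, x, hx, rfl⟩ : ((fun x => (oddCycles x).ncard) '' basicMaxFractionalMatchings G w).Nonempty)
  have hcard : (oddCycles x').ncard < (oddCycles x).ncard := hx'γ.trans_lt hγ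
  have hs := slack_of_optimal hx.2 hy
  have hs' := slack_of_optimal hx'.2 hy
  have hh := isHalfIntegral_of_extreme hx.1
  have hh' := isHalfIntegral_of_extreme hx'.1
  obtain ⟨z, hz, h01, hxz, hzx, hl, hroot⟩ := exists_rounding hh
  obtain ⟨z', hz', h01', -, hzx', hl', hroot'⟩ := exists_rounding hh'
  obtain ⟨σ, hσ, hσ0, hσ1⟩ := exists_partner hz h01
  obtain ⟨τ, hτ, hτ0, hτ1⟩ := exists_partner hz' h01'
  set A : Finset V := {v | load z v = 0 ∧ y v ≠ 0} with hA
  set B : Finset V := {v | load z' v = 0 ∧ y v ≠ 0} with hB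
  -- Each vertex of `B` lies on a cycle of `x'`, which has only one vertex exposed by `z'`.
  have hBle : B.card ≤ (oddCycles x').ncard := by
    have : ∀ b ∈ B, ∃ C ∈ oddCycles x', b ∈ cycleVertices C := fun b hb => by
      simp only [hB, Finset.mem_filter, Finset.mem_univ, true_and] at hb
      exact exists_mem_cycle_of_exposed hs' hl' hb.1 hb.2
    choose! f hf hbf using this
    rw [← Set.ncard_coe_finset]
    refine Set.ncard_le_ncard_of_injOn f hf (fun b hb b' hb' hbb => ?_) (Set.toFinite _)
    obtain ⟨r, -, hr⟩ := hroot' (f b) (hf b hb)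
    have h1 := hbf b hb
    have h2 := hbf b' hb'
    rw [← hbb] at h2
    simp only [hB, Finset.coe_filter, Finset.mem_univ, true_and, Set.mem_ofPred_eq] at hb hb'
    rw [(hr b h1).1 hb.1, (hr b' h2).1 hb'.1]
  -- The exposed vertices of the cycles of `x` are distinct by disjointness and have nonzero dual
  -- value by `hzero`.
  have hAge : (oddCycles x).ncard ≤ A.card := by
    obtain ⟨C₀, hC₀⟩ := (Set.ncard_pos (Set.toFinite _)).1 (Nat.zero_lt_of_lt hcard)
    obtain ⟨v₀, -⟩ := hroot C₀ hC₀
    have : Nonempty V := ⟨v₀⟩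
    choose! r hr hr0 using hroot
    rw [← Set.ncard_coe_finset]
    refine Set.ncard_le_ncard_of_injOn r (fun C hC => ?_) (fun C hC D hD h => ?_) (Set.toFinite _)
    · simp only [hA, Finset.coe_filter, Finset.mem_univ, true_and, Set.mem_ofPred_eq]
      exact ⟨(hr0 C hC _ (hr C hC)).2 rfl, fun h => hzero C _ ⟨hC, hr C hC, h⟩⟩
    · exact cycle_eq hh.1 hC hD (hr C hC) (h ▸ hr D hD)
  obtain ⟨a, haA, L, hL, hend⟩ := exists_zigzag_end hσ hτ (A := A) (B := B)
    (fun a ha => (hσ0 a).2 (by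
      simp only [hA, Finset.mem_filter, Finset.mem_univ, true_and] at ha
      exact ha.1)) (by omega)
  simp only [hA, hB, Finset.mem_filter, Finset.mem_univ, true_and] at haA hend
  exact exists_path_of_zigzag hh.1 hs hs' hzero hxz hzx hl hroot hzx' hσ hσ0 hσ1 hτ hτ0 hτ1
    haA.1 haA.2 hL hend

end Existence

end FractionalMatching

theorem mainTheorem3 {V : Type*} [Fintype V] [DecidableEq V] (G : SimpleGraph V)
    [DecidableRel G.Adj] (w : G.edgeSet → ℝ) (hw : ∀ e, 0 ≤ w e)
    (x : G.edgeSet → ℝ) (hx : x ∈ basicMaxFractionalMatchings G w)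
    (y : V → ℝ) (hy : y ∈ minFractionalCovers G w) :
    (gamma G w < (oddCycles x).ncard →
      (∃ C v, ZeroOnCycle x y C v) ∨
      (∃ (C D : Finset (Sym2 V)) (u v : V) (P : G.Walk u v), CycleToCycle w x y C D P) ∨
      (∃ (C : Finset (Sym2 V)) (u v : V) (P : G.Walk u v), CycleToZero w x y C P)) ∧
    (∀ (C : Finset (Sym2 V)) (v : V), ZeroOnCycle x y C v →
      ∀ c : G.Walk v v, Traverses c C →
        alternateRound c x ∈ basicMaxFractionalMatchings G w ∧
        oddCycles (alternateRound c x) ⊂ oddCycles x) ∧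
    (∀ (C D : Finset (Sym2 V)) (u v : V) (P : G.Walk u v), CycleToCycle w x y C D P →
      ∀ (c : G.Walk u u) (d : G.Walk v v), Traverses c C → Traverses d D →
        complementOn P (alternateRound d (alternateRound c x)) ∈
          basicMaxFractionalMatchings G w ∧
        oddCycles (complementOn P (alternateRound d (alternateRound c x))) ⊂ oddCycles x) ∧
    (∀ (C : Finset (Sym2 V)) (u v : V) (P : G.Walk u v), CycleToZero w x y C P →
      ∀ c : G.Walk u u, Traverses c C →
        complementOn P (alternateRound c x) ∈ basicMaxFractionalMatchings G w ∧
        oddCycles (complementOn P (alternateRound c x)) ⊂ oddCycles x) := by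
  have hs := slack_of_optimal hx.2 hy
  have hh := isHalfIntegral_of_extreme hx.1
  exact ⟨exists_structure hx hy,
    fun _ _ h _ hc => round_zeroOnCycle hh hy.1 hs h hc,
    fun _ _ _ _ _ h _ _ hc hd => round_cycleToCycle hh hy.1 hs h hc hd,
    fun _ _ _ _ h _ hc => round_cycleToZero hh hy.1 hs h hc⟩
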